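/- Conventions. Banach spaces are real, $c_{00}$ denotes the space of finitely supported real sequences $a=(a_i)_{i\ge 1}$, and $\mathbb N=\{1,2,3,\dots\}$. For $a\in c_{00}$ and $E\subset\mathbb N$ the oscillation of $a$ over $E$ is $$\operatorname{osc}(a,E)=\sup\Big\{\frac{|a_i|}{|a_j|} : i,j\in E,\ a_j\neq 0\Big\}$$ (with $\sup\emptyset=0$). A Schreier decomposition of a finite set $E\subset\mathbb N$ is a representation $E=\bigcup_{j=1}^n E_j$ with non-empty sets $E_1<E_2<\dots<E_n$ (i.e. $\max E_j<\min E_{j+1}$ for $1\le j<n$) such that $n\le\min E_1$; the empty set has the empty decomposition, with $n=0$. For $C,D,d\in[1,\infty)$, a basic sequence $(x_i)$ is $(D,d)$-bounded-oscillation-unconditional with constant $C$ if $$\Big\|\sum_{i\in E}a_ix_i\Big\|\le C\,\Big\|\sum_{i=1}^\infty a_ix_i\Big\|$$ for every $a\in c_{00}$ and every finite set $E\subset\mathbb N$ with $\operatorname{osc}(a,E)\le D$ that has a Schreier decomposition $E=\bigcup_{j=1}^nE_j$ with $\operatorname{osc}(a,E_j)\le d$ for $j=1,\dots,n$. Theorem.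 For every $d\in[1,\infty)$ there is a constant $C$ with $1\le C\le 8d$ such that for every $D\in[1,\infty)$ and every $\varepsilon>0$, every normalized weakly null sequence in a Banach space has a subsequence that is a basic sequence with basis constant at most $C+\varepsilon$ and is $(D,d)$-bounded-oscillation-unconditional with constant $C+\varepsilon$. -/

import Mathlib

open Filter Topology

noncomputable section

namespace BoundedOsc

section

variable {X : Type*} [NormedAddCommGroup X] [NormedSpace ℝ X]

/-- The sequence `x` converges to `0` in the weak topology of `X`. -/
def IsWeaklyNull (x : ℕ → X) : Prop :=
  Tendsto (fun i => toWeakSpace ℝ X (x i)) atTop (𝓝 0)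

/-- `x` is a basic sequence: a Schauder basis of its closed linear span. -/
def IsBasicSequence (x : ℕ → X) : Prop :=
  ∃ b : SchauderBasis ℝ (Submodule.span ℝ (Set.range x)).topologicalClosure,
    ∀ i, ((b i : (Submodule.span ℝ (Set.range x)).topologicalClosure) : X) = x i

/-- `x` is a basic sequence whose basis constant, the supremum of the norms of the partial sum
projections on its closed linear span, is at most `K`. -/
def IsBasicSequenceWith (K : ℝ) (x : ℕ → X) : Prop :=
  ∃ b : SchauderBasis ℝ (Submodule.span ℝ (Set.range x)).topologicalClosure,
    (∀ i, ((b i : (Submodule.span ℝ (Set.range x)).topologicalClosure) : X) = x i) ∧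
    ∀ n, ‖b.proj n‖ ≤ K

end

/-- The oscillation of the finitely supported sequence `a` over the set `E`. The supremum is over
a finite set of values, and it is `0` if `a` vanishes on `E`. -/
def osc (a : ℕ →₀ ℝ) (E : Set ℕ) : ℝ :=
  sSup {r : ℝ | ∃ i ∈ E, ∃ j ∈ E, a j ≠ 0 ∧ r = |a i| / |a j|}

/-- `F 0 < F 1 < ... < F (n - 1)` are nonempty successive sets with union `E`, and their number
`n` is at most the smallest element of `E`. Sequences are indexed from `0` here, so that `i : ℕ`
stands for the `(i + 1)`-st position: in the usual indexing by `1, 2, 3, ...` the last clause says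
`n ≤ min E`, where `min E` is the minimum of the first piece. The empty set has the empty
decomposition, with `n = 0`. -/
structure IsSchreierDecomposition (E : Finset ℕ) (n : ℕ) (F : Fin n → Finset ℕ) : Prop where
  nonempty : ∀ j, (F j).Nonempty
  successive : ∀ j k, j < k → ∀ p ∈ F j, ∀ q ∈ F k, p < q
  union : E = Finset.univ.biUnion F
  schreier : ∀ i ∈ E, n ≤ i + 1

/-- The basic sequence `x` is `(D, d)`-bounded-oscillation-unconditional with constant `C`. -/
structure IsBoundedOscUnconditional {X : Type*} [NormedAddCommGroup X] [NormedSpace ℝ X]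
    (D d C : ℝ) (x : ℕ → X) : Prop where
  basic : IsBasicSequence x
  bound : ∀ (a : ℕ →₀ ℝ) (E : Finset ℕ), osc a E ≤ D →
    (∃ (n : ℕ) (F : Fin n → Finset ℕ),
      IsSchreierDecomposition E n F ∧ ∀ j, osc a (F j) ≤ d) →
    ‖∑ i ∈ E, a i • x i‖ ≤ C * ‖∑ i ∈ a.support, a i • x i‖

end BoundedOsc

end

/-! Let `f` be a functional of norm at most one norming `∑_{i ∈ E} a_i z_i`. Only indices where
`a_i` and `f (z_i)` have the same sign help, and treating the two signs separately costs a factor 2.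
For one sign, `f` is to be replaced by a functional `g` in the dual ball which, from some time `k`
on, is almost zero off the chosen points, almost nonnegative on them, and keeps half of the weighted
mass of the pieces. Evaluating `g` on the tail of `∑ a_i z_i`, whose norm is at most `2 + δ` times
that of the whole sum, then bounds this mass. Replacing `a_i` by its minimum on a piece costs `d`;
together with 2 for the half, 2 for the tail and 2 for the signs this gives `8 * d`. The bound `D`
influences only the precision of the patterns, hence the subsequence, and not the constant.

The functional `g` comes from a game. Points generic for an ultrafilter are declared fillers or put
into pieces, in order of the pieces; a position is bad if some `f` in the dual ball carries the
prescribed masses on its pieces but no `g` is clean for it. Suppose bad positions could be forced.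
Run the strategy twice, giving both runs the same point whenever both wait to extend the same piece,
and otherwise a private point to one run. Genericity and weak nullness keep each run's functional
small on the private points of the other. In the end each pair of corresponding pieces is nested, in
one direction or the other. The pieces nested in one direction form a sufficient set (for example,
one with half of the weighted mass), or the others do; so one run's witness is clean for the other
run's position, a contradiction (`Win.not_linked`).

Positions that are not forced losses stay so for almost every next point. A fusion over finitely
many patterns per starting time therefore gives the subsequence (`exists_subsequence_clean`), and
`exists_cutoff` finds a starting time whose patterns suffice. -/

noncomputable section

namespace BoundedOsc

/-! ### The game: forcing bad positions against generic points -/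

section

/-- The data of a pattern: a number of pieces, an error, masses, and sufficient sets of pieces. -/
structure Pattern where
  size : ℕ
  err : ℝ
  mass : ℕ → ℝ
  suff : Set (Finset ℕ)

/-- The functional values `g` are small on the fillers `Z`, almost nonnegative on the pieces `E`,
and carry almost the prescribed masses on a sufficient set of pieces. -/
def IsCleanFor (P : Pattern) (Z : Finset ℕ) (E : ℕ → Finset ℕ) (g : ℕ → ℝ) : Prop :=
  ∑ z ∈ Z, |g z| + ∑ j ∈ Finset.range P.size, ∑ e ∈ E j, max (-g e) 0 ≤ P.err ∧
    ∃ J ∈ P.suff, J ⊆ Finset.range P.size ∧ ∀ j ∈ J, P.mass j - P.err ≤ ∑ e ∈ E j, g e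

/-- `f` is nonnegative on the pieces `E` and carries the prescribed masses. -/
def Carries (P : Pattern) (E : ℕ → Finset ℕ) (f : ℕ → ℝ) : Prop :=
  (∀ j < P.size, ∀ e ∈ E j, 0 ≤ f e) ∧ ∀ j < P.size, P.mass j ≤ ∑ e ∈ E j, f e

/-- The position `(Z, E)` is bad as witnessed by `f`. -/
def IsBad (K : Set (ℕ → ℝ)) (P : Pattern) (Z : Finset ℕ) (E : ℕ → Finset ℕ) (f : ℕ → ℝ) : Prop :=
  f ∈ K ∧ Carries P E f ∧ ∀ g ∈ K, ¬ IsCleanFor P Z E g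

/-- Add the point `e` to the `j`-th piece. -/
def addTo (E : ℕ → Finset ℕ) (j e : ℕ) : ℕ → Finset ℕ :=
  Function.update E j (insert e (E j))

/-- From the position `(Z, E)`, in which only pieces with index at least `p` may still grow, a bad
position can be forced against points that are generic for the ultrafilter `U`. The sequence `φ` is
the iterated limit of the witnesses. -/
inductive Win (U : Ultrafilter ℕ) (K : Set (ℕ → ℝ)) (P : Pattern) :
    ℕ → Finset ℕ → (ℕ → Finset ℕ) → (ℕ → ℝ) → Prop
  | bad (p : ℕ) (Z : Finset ℕ) (E : ℕ → Finset ℕ) (f : ℕ → ℝ) (h : IsBad K P Z E f) :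
      Win U K P p Z E f
  | filler (p : ℕ) (Z : Finset ℕ) (E : ℕ → Finset ℕ) (φ : ℕ → ℝ) (F : ℕ → ℕ → ℝ) (A : Set ℕ)
      (hA : A ∈ U) (h : ∀ e ∈ A, Win U K P p (insert e Z) E (F e))
      (hφ : ∀ i, Tendsto (fun e => F e i) U (𝓝 (φ i))) : Win U K P p Z E φ
  | piece (p j : ℕ) (Z : Finset ℕ) (E : ℕ → Finset ℕ) (φ : ℕ → ℝ) (F : ℕ → ℕ → ℝ) (A : Set ℕ)
      (hpj : p ≤ j) (hj : j < P.size)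
      (hA : A ∈ U) (h : ∀ e ∈ A, Win U K P j Z (addTo E j e) (F e))
      (hφ : ∀ i, Tendsto (fun e => F e i) U (𝓝 (φ i))) : Win U K P p Z E φ

/-- `K` consists of null sequences along `U` and is closed under pointwise limits along `U`. -/
structure IsNullClosed (U : Ultrafilter ℕ) (K : Set (ℕ → ℝ)) : Prop where
  null : ∀ f ∈ K, Tendsto f U (𝓝 0)
  closed : ∀ (F : ℕ → ℕ → ℝ) (φ : ℕ → ℝ) (A : Set ℕ), A ∈ U → (∀ e ∈ A, F e ∈ K) →
    (∀ i, Tendsto (fun e => F e i) U (𝓝 (φ i))) → φ ∈ K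
  exists_lim : ∀ (F : ℕ → ℕ → ℝ) (A : Set ℕ), A ∈ U → (∀ e ∈ A, F e ∈ K) →
    ∃ φ : ℕ → ℝ, ∀ i, Tendsto (fun e => F e i) U (𝓝 (φ i))

variable {U : Ultrafilter ℕ} {K : Set (ℕ → ℝ)} {P : Pattern}

theorem Win.mem (hK : IsNullClosed U K) {p : ℕ} {Z : Finset ℕ} {E : ℕ → Finset ℕ} {φ : ℕ → ℝ}
    (h : Win U K P p Z E φ) : φ ∈ K := by
  induction h with
  | bad p Z E f h => exact h.1
  | filler p Z E φ F A hA h hφ ih => exact hK.closed F φ A hA ih hφ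
  | piece p j Z E φ F A hpj hj hA h hφ ih => exact hK.closed F φ A hA ih hφ

/-- The total size of `φ` on the points of `(Z, E)` that do not occur in the pieces `E'`. -/
def privateSum (P : Pattern) (φ : ℕ → ℝ) (Z : Finset ℕ) (E E' : ℕ → Finset ℕ) : ℝ :=
  ∑ z ∈ Z, |φ z| + ∑ j ∈ Finset.range P.size, ∑ e ∈ E j \ E' j, |φ e|

theorem tendsto_privateSum {F : ℕ → ℕ → ℝ} {φ : ℕ → ℝ}
    (hφ : ∀ i, Tendsto (fun e => F e i) U (𝓝 (φ i))) (Z : Finset ℕ) (E E' : ℕ → Finset ℕ) :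
    Tendsto (fun e => privateSum P (F e) Z E E') U (𝓝 (privateSum P φ Z E E')) := by
  unfold privateSum
  refine Tendsto.add (tendsto_finsetSum _ fun i _ => (hφ i).abs)
    (tendsto_finsetSum _ fun j _ => tendsto_finsetSum _ fun i _ => (hφ i).abs)

theorem privateSum_mono {φ : ℕ → ℝ} {Z : Finset ℕ} {E E' D D' : ℕ → Finset ℕ}
    (h : ∀ j, E j \ E' j ⊆ D j \ D' j) : privateSum P φ Z E E' ≤ privateSum P φ Z D D' := by
  unfold privateSum
  refine add_le_add le_rfl (Finset.sum_le_sum fun j _ => ?_)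
  exact Finset.sum_le_sum_of_subset_of_nonneg (h j) fun _ _ _ => abs_nonneg _

theorem subset_addTo (E : ℕ → Finset ℕ) (j e i : ℕ) : E i ⊆ addTo E j e i := by
  unfold addTo
  by_cases h : i = j
  · subst h; simp
  · simp [h]

theorem addTo_self (E : ℕ → Finset ℕ) (j e : ℕ) : addTo E j e j = insert e (E j) := by
  simp [addTo]

theorem addTo_of_ne (E : ℕ → Finset ℕ) {j i : ℕ} (e : ℕ) (h : i ≠ j) : addTo E j e i = E i := by
  simp [addTo, h]

theorem privateSum_insert_le (φ : ℕ → ℝ) (Z : Finset ℕ) (E E' : ℕ → Finset ℕ) (e : ℕ) :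
    privateSum P φ (insert e Z) E E' ≤ privateSum P φ Z E E' + |φ e| := by
  unfold privateSum
  have : ∑ z ∈ insert e Z, |φ z| ≤ |φ e| + ∑ z ∈ Z, |φ z| := by
    by_cases h : e ∈ Z
    · rw [Finset.insert_eq_of_mem h]; linarith [abs_nonneg (φ e)]
    · rw [Finset.sum_insert h]
  linarith

theorem privateSum_addTo_le (φ : ℕ → ℝ) (Z : Finset ℕ) (E E' : ℕ → Finset ℕ) (j e : ℕ) :
    privateSum P φ Z (addTo E j e) E' ≤ privateSum P φ Z E E' + |φ e| := by
  unfold privateSum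
  have key : ∀ i, ∑ e ∈ addTo E j e i \ E' i, |φ e| ≤
      ∑ e ∈ E i \ E' i, |φ e| + if i = j then |φ e| else 0 := by
    intro i
    split_ifs with h
    · subst h
      rw [addTo_self]
      calc ∑ x ∈ insert e (E i) \ E' i, |φ x| ≤ ∑ x ∈ insert e (E i \ E' i), |φ x| := by
            apply Finset.sum_le_sum_of_subset_of_nonneg
            · intro x hx; simp only [Finset.mem_sdiff, Finset.mem_insert] at hx ⊢; tauto
            · intros; positivity
        _ ≤ _ := by
            by_cases h : e ∈ E i \ E' i
            · rw [Finset.insert_eq_of_mem h]; linarith [abs_nonneg (φ e)]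
            · rw [Finset.sum_insert h]; linarith
    · rw [addTo_of_ne _ _ h]; simp
  have h2 := Finset.sum_le_sum (s := Finset.range P.size) fun i _ => key i
  rw [Finset.sum_add_distrib, Finset.sum_ite_eq'] at h2
  have : (if j ∈ Finset.range P.size then |φ e| else 0) ≤ |φ e| := by
    split_ifs
    · exact le_rfl
    · positivity
  linarith

/-- The invariant linking two simultaneous runs of a strategy. -/
structure Linked (P : Pattern) (p₁ : ℕ) (Z₁ : Finset ℕ) (E₁ : ℕ → Finset ℕ) (φ₁ : ℕ → ℝ)
    (p₂ : ℕ) (Z₂ : Finset ℕ) (E₂ : ℕ → Finset ℕ) (φ₂ : ℕ → ℝ) : Prop where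
  small₁ : privateSum P φ₁ Z₂ E₂ E₁ < P.err
  small₂ : privateSum P φ₂ Z₁ E₁ E₂ < P.err
  nested : ∀ j, E₁ j ⊆ E₂ j ∨ E₂ j ⊆ E₁ j
  past₁ : ∀ j, ¬ E₂ j ⊆ E₁ j → j < p₁
  past₂ : ∀ j, ¬ E₁ j ⊆ E₂ j → j < p₂

section Linked

variable {p₁ p₂ : ℕ} {Z₁ Z₂ : Finset ℕ} {E₁ E₂ : ℕ → Finset ℕ} {φ₁ φ₂ : ℕ → ℝ}

theorem Linked.symm (h : Linked P p₁ Z₁ E₁ φ₁ p₂ Z₂ E₂ φ₂) :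
    Linked P p₂ Z₂ E₂ φ₂ p₁ Z₁ E₁ φ₁ :=
  ⟨h.small₂, h.small₁, fun j => (h.nested j).symm, h.past₂, h.past₁⟩

theorem Linked.mono {q₁ q₂ : ℕ} (h : Linked P p₁ Z₁ E₁ φ₁ p₂ Z₂ E₂ φ₂) (h₁ : p₁ ≤ q₁)
    (h₂ : p₂ ≤ q₂) : Linked P q₁ Z₁ E₁ φ₁ q₂ Z₂ E₂ φ₂ :=
  ⟨h.small₁, h.small₂, h.nested, fun j hj => (h.past₁ j hj).trans_le h₁,
    fun j hj => (h.past₂ j hj).trans_le h₂⟩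

/-- The new point is charged only to `φ₂`, which tends to zero along `U`. Replacing `φ₁` by `F e`
changes finitely many values by arbitrarily little, so both strict inequalities survive. -/
theorem Linked.eventually_filler (h : Linked P p₁ Z₁ E₁ φ₁ p₂ Z₂ E₂ φ₂)
    (hφ₂ : Tendsto φ₂ U (𝓝 0)) {F : ℕ → ℕ → ℝ}
    (hF : ∀ i, Tendsto (fun e => F e i) U (𝓝 (φ₁ i))) :
    ∀ᶠ e in (U : Filter ℕ), Linked P p₁ (insert e Z₁) E₁ (F e) p₂ Z₂ E₂ φ₂ := by
  have h1 := (tendsto_privateSum (P := P) hF Z₂ E₂ E₁).eventually_lt_const h.small₁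
  have h2 : ∀ᶠ e in (U : Filter ℕ), privateSum P φ₂ Z₁ E₁ E₂ + |φ₂ e| < P.err := by
    have : Tendsto (fun e => privateSum P φ₂ Z₁ E₁ E₂ + |φ₂ e|) U
        (𝓝 (privateSum P φ₂ Z₁ E₁ E₂ + |(0 : ℝ)|)) := tendsto_const_nhds.add hφ₂.abs
    exact this.eventually_lt_const (by simpa using h.small₂)
  filter_upwards [h1, h2] with e h1 h2
  exact ⟨h1, (privateSum_insert_le _ _ _ _ _).trans_lt h2, h.nested, h.past₁, h.past₂⟩

/-- Run 2 has already passed piece `j`, so run 1 may extend it alone. Run 1 has not passed it, so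
its piece already contains that of run 2, and nestedness is preserved. -/
theorem Linked.eventually_private (h : Linked P p₁ Z₁ E₁ φ₁ p₂ Z₂ E₂ φ₂)
    (hφ₂ : Tendsto φ₂ U (𝓝 0)) {F : ℕ → ℕ → ℝ}
    (hF : ∀ i, Tendsto (fun e => F e i) U (𝓝 (φ₁ i))) {j : ℕ} (hj₁ : p₁ ≤ j) (hj₂ : j < p₂) :
    ∀ᶠ e in (U : Filter ℕ), Linked P j Z₁ (addTo E₁ j e) (F e) p₂ Z₂ E₂ φ₂ := by
  have h1 := (tendsto_privateSum (P := P) hF Z₂ E₂ E₁).eventually_lt_const h.small₁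
  have h2 : ∀ᶠ e in (U : Filter ℕ), privateSum P φ₂ Z₁ E₁ E₂ + |φ₂ e| < P.err := by
    have : Tendsto (fun e => privateSum P φ₂ Z₁ E₁ E₂ + |φ₂ e|) U
        (𝓝 (privateSum P φ₂ Z₁ E₁ E₂ + |(0 : ℝ)|)) := tendsto_const_nhds.add hφ₂.abs
    exact this.eventually_lt_const (by simpa using h.small₂)
  filter_upwards [h1, h2] with e h1 h2
  have hsub : E₂ j ⊆ E₁ j := by
    by_contra hc
    exact absurd (h.past₁ j hc) (by omega)
  refine ⟨lt_of_le_of_lt (privateSum_mono fun i => Finset.sdiff_subset_sdiff subset_rfl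
    (subset_addTo _ _ _ _)) h1, (privateSum_addTo_le _ _ _ _ _ _).trans_lt h2, fun i => ?_,
    fun i hi => ?_, fun i hi => ?_⟩
  · by_cases hij : i = j
    · subst hij
      exact Or.inr (hsub.trans (subset_addTo _ _ _ _))
    · rw [addTo_of_ne _ _ hij]
      exact h.nested i
  · have : ¬ E₂ i ⊆ E₁ i := fun hc => hi (hc.trans (subset_addTo _ _ _ _))
    exact (h.past₁ i this).trans_le hj₁
  · by_cases hij : i = j
    · subst hij; exact hj₂
    · rw [addTo_of_ne _ _ hij] at hi
      exact h.past₂ i hi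

/-- A shared point adds nothing to either difference of pieces, so no smallness at `e` is needed,
and neither functional is known to be small there. -/
theorem Linked.eventually_common (h : Linked P p₁ Z₁ E₁ φ₁ p₂ Z₂ E₂ φ₂) {F₁ F₂ : ℕ → ℕ → ℝ}
    (hF₁ : ∀ i, Tendsto (fun e => F₁ e i) U (𝓝 (φ₁ i)))
    (hF₂ : ∀ i, Tendsto (fun e => F₂ e i) U (𝓝 (φ₂ i))) {j : ℕ} (hj₁ : p₁ ≤ j) (hj₂ : p₂ ≤ j) :
    ∀ᶠ e in (U : Filter ℕ),
      Linked P j Z₁ (addTo E₁ j e) (F₁ e) j Z₂ (addTo E₂ j e) (F₂ e) := by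
  have h1 := (tendsto_privateSum (P := P) hF₁ Z₂ E₂ E₁).eventually_lt_const h.small₁
  have h2 := (tendsto_privateSum (P := P) hF₂ Z₁ E₁ E₂).eventually_lt_const h.small₂
  have key : ∀ (E E' : ℕ → Finset ℕ) (e i : ℕ),
      addTo E j e i \ addTo E' j e i ⊆ E i \ E' i := by
    intro E E' e i
    by_cases hij : i = j
    · subst hij
      rw [addTo_self, addTo_self]
      intro x hx
      simp only [Finset.mem_sdiff, Finset.mem_insert] at hx ⊢
      tauto
    · rw [addTo_of_ne _ _ hij, addTo_of_ne _ _ hij]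
  have key2 : ∀ (E E' : ℕ → Finset ℕ) (e i : ℕ), E i ⊆ E' i → addTo E j e i ⊆ addTo E' j e i := by
    intro E E' e i hE
    by_cases hij : i = j
    · subst hij
      rw [addTo_self, addTo_self]
      exact Finset.insert_subset_insert _ hE
    · rwa [addTo_of_ne _ _ hij, addTo_of_ne _ _ hij]
  filter_upwards [h1, h2] with e h1 h2
  exact ⟨(privateSum_mono fun i => key _ _ _ _).trans_lt h1,
    (privateSum_mono fun i => key _ _ _ _).trans_lt h2,
    fun i => (h.nested i).imp (key2 _ _ _ _) (key2 _ _ _ _),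
    fun i hi => (h.past₁ i fun hc => hi (key2 _ _ _ _ hc)).trans_le hj₁,
    fun i hi => (h.past₂ i fun hc => hi (key2 _ _ _ _ hc)).trans_le hj₂⟩

/-- On the common part of the pieces `φ₁` is nonnegative, so its negative part lives on the private
points of run 2. Where run 2's piece is the larger one, it retains the whole mass of `φ₁` up to
those points. -/
theorem isCleanFor_of_nested (hsm : privateSum P φ₁ Z₂ E₂ E₁ < P.err) (hc : Carries P E₁ φ₁)
    {J : Finset ℕ} (hJ : J ∈ P.suff) (hJr : J ⊆ Finset.range P.size)
    (hJE : ∀ j ∈ J, E₁ j ⊆ E₂ j) :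
    IsCleanFor P Z₂ E₂ φ₁ := by
  have hneg : ∀ j < P.size, ∑ e ∈ E₂ j, max (-φ₁ e) 0 ≤ ∑ e ∈ E₂ j \ E₁ j, |φ₁ e| := by
    intro j hj
    rw [← Finset.sum_inter_add_sum_sdiff (E₂ j) (E₁ j)]
    have : ∑ e ∈ E₂ j ∩ E₁ j, max (-φ₁ e) 0 = 0 := by
      refine Finset.sum_eq_zero fun e he => ?_
      have := hc.1 j hj e (Finset.mem_of_mem_inter_right he)
      exact max_eq_right (by linarith)
    rw [this, zero_add]
    exact Finset.sum_le_sum fun e _ => max_le (neg_le_abs _) (abs_nonneg _)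
  refine ⟨?_, J, hJ, hJr, fun j hj => ?_⟩
  · refine le_trans ?_ hsm.le
    unfold privateSum
    gcongr with j hj
    exact hneg j (Finset.mem_range.1 hj)
  · have hj' := hJr hj
    rw [← Finset.sum_sdiff (hJE j hj)]
    have h1 := hc.2 j (Finset.mem_range.1 hj')
    have h2 : -∑ e ∈ E₂ j \ E₁ j, |φ₁ e| ≤ ∑ e ∈ E₂ j \ E₁ j, φ₁ e := by
      rw [← Finset.sum_neg_distrib]
      exact Finset.sum_le_sum fun e _ => neg_abs_le _
    have h3 : ∑ e ∈ E₂ j \ E₁ j, |φ₁ e| ≤ privateSum P φ₁ Z₂ E₂ E₁ := by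
      unfold privateSum
      have := Finset.single_le_sum (f := fun j => ∑ e ∈ E₂ j \ E₁ j, |φ₁ e|)
        (fun i _ => Finset.sum_nonneg fun e _ => abs_nonneg _) hj'
      have h0 : 0 ≤ ∑ z ∈ Z₂, |φ₁ z| := Finset.sum_nonneg fun e _ => abs_nonneg _
      linarith
    linarith

end Linked

/-- Two linked runs cannot both be won. -/
theorem Win.not_linked (hK : IsNullClosed U K)
    (hP : ∀ J ⊆ Finset.range P.size, J ∈ P.suff ∨ Finset.range P.size \ J ∈ P.suff)
    {p₁ : ℕ} {Z₁ : Finset ℕ} {E₁ : ℕ → Finset ℕ} {φ₁ : ℕ → ℝ} (h₁ : Win U K P p₁ Z₁ E₁ φ₁) :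
    ∀ {p₂ : ℕ} {Z₂ : Finset ℕ} {E₂ : ℕ → Finset ℕ} {φ₂ : ℕ → ℝ}, Win U K P p₂ Z₂ E₂ φ₂ →
      ¬ Linked P p₁ Z₁ E₁ φ₁ p₂ Z₂ E₂ φ₂ := by
  induction h₁ with
  | bad p₁ Z₁ E₁ f₁ hf₁ =>
    have hf₁K := hf₁.1
    intro p₂ Z₂ E₂ φ₂ h₂ hL
    -- Run 1 has ended, so every piece counts as passed by it and all further moves of run 2 are
    -- private.
    replace hL := hL.mono (le_max_left p₁ P.size) le_rfl
    generalize hq : max p₁ P.size = q at hL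
    have hqs : P.size ≤ q := hq ▸ le_max_right _ _
    clear hq
    induction h₂ with
    | bad p₂ Z₂ E₂ f₂ hf₂ =>
      classical
      set J := (Finset.range P.size).filter fun j => E₁ j ⊆ E₂ j with hJ
      rcases hP J (Finset.filter_subset _ _) with h | h
      · exact hf₂.2.2 f₁ hf₁.1 (isCleanFor_of_nested hL.small₁ hf₁.2.1 h
          (Finset.filter_subset _ _) fun j hj => (Finset.mem_filter.1 hj).2)
      · refine hf₁.2.2 f₂ hf₂.1 (isCleanFor_of_nested hL.small₂ hf₂.2.1 h
          Finset.sdiff_subset fun j hj => ?_)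
        rw [hJ, Finset.mem_sdiff, Finset.mem_filter] at hj
        exact (hL.nested j).resolve_left fun hc => hj.2 ⟨hj.1, hc⟩
    | filler p₂ Z₂ E₂ φ₂ F A hA h hφ ih =>
      obtain ⟨e, he, hLe⟩ := ((eventually_mem_set.2 hA).and
        (hL.symm.eventually_filler (hK.null _ hf₁K) hφ)).exists
      exact ih e he hLe.symm
    | piece p₂ j Z₂ E₂ φ₂ F A hpj hj hA h hφ ih =>
      obtain ⟨e, he, hLe⟩ := ((eventually_mem_set.2 hA).and
        (hL.symm.eventually_private (hK.null _ hf₁K) hφ hpj (hj.trans_le hqs))).exists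
      exact ih e he hLe.symm
  | filler p₁ Z₁ E₁ φ₁ F A hA h hφ ih =>
    intro p₂ Z₂ E₂ φ₂ h₂ hL
    obtain ⟨e, he, hLe⟩ := ((eventually_mem_set.2 hA).and
      (hL.eventually_filler (hK.null _ (h₂.mem hK)) hφ)).exists
    exact ih e he h₂ hLe
  | piece p₁ j₁ Z₁ E₁ φ₁ F₁ A₁ hpj₁ hj₁ hA₁ h₁ hφ₁ ih₁ =>
    have hφ₁K : φ₁ ∈ K := hK.closed F₁ φ₁ A₁ hA₁ (fun e he => (h₁ e he).mem hK) hφ₁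
    intro p₂ Z₂ E₂ φ₂ h₂ hL
    -- Run 1 is committed to piece `j₁` but waits; run 2 is advanced until it ends or its pending
    -- piece is at least `j₁`.
    replace hL := hL.mono hpj₁ le_rfl
    induction h₂ with
    | bad p₂ Z₂ E₂ f₂ hf₂ =>
      replace hL := hL.mono le_rfl (le_max_left p₂ P.size)
      obtain ⟨e, he, hLe⟩ := ((eventually_mem_set.2 hA₁).and
        (hL.eventually_private (hK.null _ hf₂.1) hφ₁ le_rfl
          (hj₁.trans_le (le_max_right _ _)))).exists
      exact ih₁ e he (Win.bad _ _ _ _ hf₂) hLe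
    | filler p₂ Z₂ E₂ φ₂ F A hA h hφ ih =>
      obtain ⟨e, he, hLe⟩ := ((eventually_mem_set.2 hA).and
        (hL.symm.eventually_filler (hK.null _ hφ₁K) hφ)).exists
      exact ih e he hLe.symm
    | piece p₂ j₂ Z₂ E₂ φ₂ F₂ A₂ hpj₂ hj₂ hA₂ h₂ hφ₂ ih₂ =>
      replace hL := hL.mono le_rfl hpj₂
      -- The run waiting at the smaller index moves privately, since the other has passed that
      -- piece; at equal indices both receive the same point.
      rcases lt_trichotomy j₁ j₂ with hlt | heq | hgt
      · have hW := Win.piece j₂ j₂ Z₂ E₂ φ₂ F₂ A₂ le_rfl hj₂ hA₂ h₂ hφ₂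
        obtain ⟨e, he, hLe⟩ := ((eventually_mem_set.2 hA₁).and
          (hL.eventually_private (hK.null _ (hW.mem hK)) hφ₁ le_rfl hlt)).exists
        exact ih₁ e he hW hLe
      · subst heq
        obtain ⟨e, ⟨he₁, he₂⟩, hLe⟩ := (((eventually_mem_set.2 hA₁).and
          (eventually_mem_set.2 hA₂)).and
          (hL.eventually_common hφ₁ hφ₂ le_rfl le_rfl)).exists
        exact ih₁ e he₁ (h₂ e he₂) hLe
      · obtain ⟨e, he, hLe⟩ := ((eventually_mem_set.2 hA₂).and
          (hL.symm.eventually_private (hK.null _ hφ₁K) hφ₂ le_rfl hgt)).exists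
        exact ih₂ e he hLe.symm

/-- A bad position cannot be forced from the empty position. -/
theorem not_win_empty (hK : IsNullClosed U K)
    (hP : ∀ J ⊆ Finset.range P.size, J ∈ P.suff ∨ Finset.range P.size \ J ∈ P.suff)
    (herr : 0 < P.err) (φ : ℕ → ℝ) : ¬ Win U K P 0 ∅ (fun _ => ∅) φ := fun h =>
  h.not_linked hK hP h
    ⟨by simpa [privateSum] using herr, by simpa [privateSum] using herr, fun j => by simp,
      fun j hj => by simp at hj, fun j hj => by simp at hj⟩

/-- No bad position can be forced from the position `(Z, E)`. -/
def IsSafe (U : Ultrafilter ℕ) (K : Set (ℕ → ℝ)) (P : Pattern) (p : ℕ) (Z : Finset ℕ)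
    (E : ℕ → Finset ℕ) : Prop :=
  ∀ φ, ¬ Win U K P p Z E φ

/-- Otherwise, `U` being an ultrafilter, almost every point leads to a win; the limit of the chosen
witnesses then makes the present position a win. -/
theorem IsSafe.eventually_filler (hK : IsNullClosed U K) {p : ℕ} {Z : Finset ℕ}
    {E : ℕ → Finset ℕ} (h : IsSafe U K P p Z E) :
    ∀ᶠ e in (U : Filter ℕ), IsSafe U K P p (insert e Z) E := by
  by_contra hc
  rw [← Ultrafilter.eventually_not] at hc
  unfold IsSafe at hc
  push Not at hc
  choose! F hF using fun (e : ℕ) (he : ∃ φ, Win U K P p (insert e Z) E φ) => he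
  obtain ⟨φ, hφ⟩ := hK.exists_lim F _ hc fun e he => (hF e he).mem hK
  exact h φ (Win.filler p Z E φ F _ hc hF hφ)

theorem IsSafe.eventually_piece (hK : IsNullClosed U K) {p j : ℕ} {Z : Finset ℕ}
    {E : ℕ → Finset ℕ} (h : IsSafe U K P p Z E) (hpj : p ≤ j) (hj : j < P.size) :
    ∀ᶠ e in (U : Filter ℕ), IsSafe U K P j Z (addTo E j e) := by
  by_contra hc
  rw [← Ultrafilter.eventually_not] at hc
  unfold IsSafe at hc
  push Not at hc
  choose! F hF using fun (e : ℕ) (he : ∃ φ, Win U K P j Z (addTo E j e) φ) => he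
  obtain ⟨φ, hφ⟩ := hK.exists_lim F _ hc fun e he => (hF e he).mem hK
  exact h φ (Win.piece p j Z E φ F _ hpj hj hc hF hφ)

theorem IsSafe.not_isBad {p : ℕ} {Z : Finset ℕ} {E : ℕ → Finset ℕ} (h : IsSafe U K P p Z E)
    (f : ℕ → ℝ) : ¬ IsBad K P Z E f := fun hf => h f (Win.bad p Z E f hf)

theorem IsSafe.exists_isCleanFor {p : ℕ} {Z : Finset ℕ} {E : ℕ → Finset ℕ}
    (h : IsSafe U K P p Z E) {f : ℕ → ℝ} (hf : f ∈ K) (hc : Carries P E f) :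
    ∃ g ∈ K, IsCleanFor P Z E g := by
  by_contra hn
  push Not at hn
  exact h.not_isBad f ⟨hf, hc, hn⟩

end

/-! ### Fusion: a subsequence all of whose positions are safe -/

section

/-- A fusion argument along an ultrafilter: given finitely branching states whose successors are
good for almost every point, there is an increasing sequence along which all states reached from
finitely many new good initial states at each time are good. -/
theorem exists_strictMono_fusion {S : Type*} {U : Ultrafilter ℕ} (hU : (U : Filter ℕ) ≤ atTop)
    (Good : S → Prop) (child : S → ℕ → Set S) (hfin : ∀ s e, (child s e).Finite)
    (hgood : ∀ s, Good s → ∀ᶠ e in (U : Filter ℕ), ∀ s' ∈ child s e, Good s')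
    (init : ℕ → Set S) (hinit : ∀ t, (init t).Finite) (hinitg : ∀ t, ∀ s ∈ init t, Good s) :
    ∃ m : ℕ → ℕ, StrictMono m ∧ ∃ A : ℕ → Set S, (∀ t, init t ⊆ A t) ∧
      (∀ t, ∀ s ∈ A t, child s (m t) ⊆ A (t + 1)) ∧ ∀ t, ∀ s ∈ A t, Good s := by
  -- Only finitely many states are active at a time, so one point serves them all.
  have step : ∀ (A : {A : Set S // A.Finite ∧ ∀ s ∈ A, Good s}) (n : ℕ),
      ∃ e, n < e ∧ ∀ s ∈ A.1, ∀ s' ∈ child s e, Good s' := by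
    rintro ⟨A, hA, hAg⟩ n
    have h1 : ∀ᶠ e in (U : Filter ℕ), ∀ s ∈ A, ∀ s' ∈ child s e, Good s' :=
      (hA.eventually_all).2 fun s hs => hgood s (hAg s hs)
    exact ((Filter.Eventually.filter_mono hU (eventually_gt_atTop n)).and h1).exists
  choose nxt hnxt hnxtg using step
  let T := {A : Set S // A.Finite ∧ ∀ s ∈ A, Good s} × ℕ
  let seq : ℕ → T := fun t => Nat.rec (motive := fun _ => T)
    (⟨init 0, hinit 0, hinitg 0⟩, 0)
    (fun t q => (⟨(⋃ s ∈ q.1.1, child s (nxt q.1 q.2)) ∪ init (t + 1),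
      (q.1.2.1.biUnion fun s _ => hfin s _).union (hinit _), by
        rintro s (hs | hs)
        · simp only [Set.mem_iUnion] at hs
          obtain ⟨r, hr, hs⟩ := hs
          exact hnxtg q.1 q.2 r hr s hs
        · exact hinitg _ s hs⟩, nxt q.1 q.2)) t
  refine ⟨fun t => (seq (t + 1)).2, strictMono_nat_of_lt_succ fun t => hnxt _ _,
    fun t => (seq t).1.1, fun t => ?_, fun t s hs => ?_, fun t s hs => (seq t).1.2.2 s hs⟩
  · cases t with
    | zero => exact subset_rfl
    | succ t => exact Set.subset_union_right
  · exact Set.subset_union_of_subset_left (Set.subset_biUnion_of_mem (u := fun s => child s _) hs) _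

variable {U : Ultrafilter ℕ} {K : Set (ℕ → ℝ)}

/-- The fillers played before time `T` when the marks `c` are used from time `k` on. -/
def fillersOf (m : ℕ → ℕ) (c : ℕ → Option ℕ) (k T : ℕ) : Finset ℕ :=
  ((Finset.Ico k T).filter fun t => c t = none).image m

/-- The pieces played before time `T` when the marks `c` are used from time `k` on. -/
def piecesOf (m : ℕ → ℕ) (c : ℕ → Option ℕ) (k T : ℕ) (j : ℕ) : Finset ℕ :=
  ((Finset.Ico k T).filter fun t => c t = some j).image m

theorem exists_subsequence_safe (hU : (U : Filter ℕ) ≤ atTop) (hK : IsNullClosed U K)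
    (Λ : ℕ → Set Pattern) (hΛ : ∀ k, (Λ k).Finite)
    (hP : ∀ k, ∀ P ∈ Λ k, 0 < P.err ∧
      ∀ J ⊆ Finset.range P.size, J ∈ P.suff ∨ Finset.range P.size \ J ∈ P.suff) :
    ∃ m : ℕ → ℕ, StrictMono m ∧ ∀ k, ∀ P ∈ Λ k, ∀ T ≥ k, ∀ c : ℕ → Option ℕ,
      (∀ t j, c t = some j → j < P.size) →
      (∀ t t' j j', t < t' → c t = some j → c t' = some j' → j ≤ j') →
      ∃ p, IsSafe U K P p (fillersOf m c k T) (piecesOf m c k T) := by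
  obtain ⟨m, hm, A, hinit, hchild, hA⟩ := exists_strictMono_fusion hU
    (S := Pattern × ℕ × Finset ℕ × (ℕ → Finset ℕ))
    (fun s => IsSafe U K s.1 s.2.1 s.2.2.1 s.2.2.2)
    (fun s e => {(s.1, s.2.1, insert e s.2.2.1, s.2.2.2)} ∪
      (fun j => (s.1, j, s.2.2.1, addTo s.2.2.2 j e)) '' Set.Ico s.2.1 s.1.size)
    (fun s e => (Set.finite_singleton _).union ((Set.finite_Ico _ _).image _))
    (by
      rintro ⟨P, p, Z, E⟩ hs
      have h2 : ∀ᶠ e in (U : Filter ℕ), ∀ j ∈ Set.Ico p P.size, IsSafe U K P j Z (addTo E j e) :=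
        ((Set.finite_Ico p P.size).eventually_all).2 fun j hj => hs.eventually_piece hK hj.1 hj.2
      filter_upwards [hs.eventually_filler hK, h2] with e h1 h2
      rintro s' (rfl | ⟨j, hj, rfl⟩)
      · exact h1
      · exact h2 j hj)
    (fun k => (fun P => (P, 0, ∅, fun _ => ∅)) '' Λ k) (fun k => (hΛ k).image _)
    (by
      rintro k _ ⟨P, hPk, rfl⟩
      exact not_win_empty hK (hP k P hPk).2 (hP k P hPk).1)
  refine ⟨m, hm, fun k P hPk T hT c hc hmono => ?_⟩
  -- The induction also needs that `p` does not exceed any later mark, so that the next piece move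
  -- is legal.
  suffices h : ∃ p, (P, p, fillersOf m c k T, piecesOf m c k T) ∈ A T ∧
      ∀ t ≥ T, ∀ j, c t = some j → p ≤ j by
    obtain ⟨p, hp, -⟩ := h
    exact ⟨p, hA T _ hp⟩
  induction T, hT using Nat.le_induction with
  | base =>
    refine ⟨0, hinit k ⟨P, hPk, ?_⟩, fun _ _ _ _ => Nat.zero_le _⟩
    have : piecesOf m c k k = fun _ => ∅ := by funext j; simp [piecesOf]
    simp [fillersOf, this]
  | succ T hkT ih =>
    obtain ⟨p, hp, hlater⟩ := ih
    have hIco : Finset.Ico k (T + 1) = insert T (Finset.Ico k T) := by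
      ext t; simp only [Finset.mem_Ico, Finset.mem_insert]; omega
    cases hcT : c T with
    | none =>
      refine ⟨p, hchild T _ hp (Or.inl ?_), fun t ht j hj => hlater t (by omega) j hj⟩
      have h1 : fillersOf m c k (T + 1) = insert (m T) (fillersOf m c k T) := by
        simp [fillersOf, hIco, Finset.filter_insert, hcT]
      have h2 : piecesOf m c k (T + 1) = piecesOf m c k T := by
        funext j; simp [piecesOf, hIco, Finset.filter_insert, hcT]
      simp [h1, h2]
    | some j =>
      refine ⟨j, hchild T _ hp (Or.inr ⟨j, ⟨hlater T le_rfl j hcT, hc T j hcT⟩, ?_⟩),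
        fun t ht i hi => hmono T t j i (by omega) hcT hi⟩
      have h1 : fillersOf m c k (T + 1) = fillersOf m c k T := by
        simp [fillersOf, hIco, Finset.filter_insert, hcT]
      have h2 : piecesOf m c k (T + 1) = addTo (piecesOf m c k T) j (m T) := by
        funext i
        by_cases hij : i = j
        · subst hij
          rw [addTo_self]
          simp [piecesOf, hIco, Finset.filter_insert, hcT]
        · rw [addTo_of_ne _ _ hij]
          simp [piecesOf, hIco, Finset.filter_insert, hcT, Ne.symm hij]
      simp [h1, h2]

/-- Successive sets are encoded as marks: a time in `G j` plays piece `j`, any other time from `k`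
on plays a filler. The resulting position is safe, hence not bad. -/
theorem exists_subsequence_clean (hU : (U : Filter ℕ) ≤ atTop) (hK : IsNullClosed U K)
    (Λ : ℕ → Set Pattern) (hΛ : ∀ k, (Λ k).Finite)
    (hP : ∀ k, ∀ P ∈ Λ k, 0 < P.err ∧
      ∀ J ⊆ Finset.range P.size, J ∈ P.suff ∨ Finset.range P.size \ J ∈ P.suff) :
    ∃ m : ℕ → ℕ, StrictMono m ∧ ∀ k, ∀ P ∈ Λ k, ∀ T ≥ k, ∀ G : ℕ → Finset ℕ,
      (∀ j, G j ⊆ Finset.Ico k T) → (∀ j ≥ P.size, G j = ∅) →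
      (∀ i j, i < j → ∀ p ∈ G i, ∀ q ∈ G j, p < q) →
      ∀ f ∈ K, Carries P G (f ∘ m) →
        ∃ g ∈ K, IsCleanFor P (Finset.Ico k T \ (Finset.range P.size).biUnion G) G (g ∘ m) := by
  classical
  obtain ⟨m, hm, hsafe⟩ := exists_subsequence_safe hU hK Λ hΛ hP
  refine ⟨m, hm, fun k P hPk T hT G hGT hG0 hGs f hf hc => ?_⟩
  have huniq : ∀ t i j, t ∈ G i → t ∈ G j → i = j := by
    intro t i j hi hj
    rcases lt_trichotomy i j with h | h | h
    · exact absurd (hGs i j h t hi t hj) (lt_irrefl _)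
    · exact h
    · exact absurd (hGs j i h t hj t hi) (lt_irrefl _)
  let c : ℕ → Option ℕ := fun t => if h : ∃ j, t ∈ G j then some h.choose else none
  have hcs : ∀ t j, c t = some j ↔ t ∈ G j := by
    intro t j
    by_cases h : ∃ j, t ∈ G j
    · simp only [c, dif_pos h, Option.some.injEq]
      exact ⟨fun e => e ▸ h.choose_spec, fun e => huniq t _ _ h.choose_spec e⟩
    · simp only [c, dif_neg h]
      exact ⟨fun e => by simp at e, fun e => absurd ⟨j, e⟩ h⟩
  have hcn : ∀ t, c t = none ↔ ∀ j, t ∉ G j := by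
    intro t
    rw [Option.eq_none_iff_forall_ne_some]
    exact forall_congr' fun j => not_congr (hcs t j)
  have hsz : ∀ t j, t ∈ G j → j < P.size := by
    intro t j h
    by_contra hj
    simp [hG0 j (not_lt.1 hj)] at h
  obtain ⟨p, hp⟩ := hsafe k P hPk T hT c (fun t j h => hsz t j ((hcs t j).1 h))
    (fun t t' j j' htt h h' => by
      by_contra hlt
      have := hGs j' j (not_le.1 hlt) t' ((hcs _ _).1 h') t ((hcs _ _).1 h)
      omega)
  have hZ : fillersOf m c k T =
      (Finset.Ico k T \ (Finset.range P.size).biUnion G).image m := by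
    unfold fillersOf
    congr 1
    ext t
    simp only [Finset.mem_filter, hcn, Finset.mem_sdiff, Finset.mem_biUnion, Finset.mem_range]
    refine and_congr_right fun _ => ⟨fun h ⟨j, _, hj⟩ => h j hj, fun h j hj => h ⟨j, hsz t j hj, hj⟩⟩
  have hE : piecesOf m c k T = fun j => (G j).image m := by
    funext j
    unfold piecesOf
    congr 1
    ext t
    simp only [Finset.mem_filter, hcs]
    exact ⟨fun h => h.2, fun h => ⟨hGT j h, h⟩⟩
  rw [hZ, hE] at hp
  have hsum : ∀ (A : Finset ℕ) (u : ℕ → ℝ), ∑ e ∈ A.image m, u e = ∑ t ∈ A, u (m t) :=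
    fun A u => Finset.sum_image (hm.injective.injOn)
  obtain ⟨g, hg, hgc⟩ := hp.exists_isCleanFor hf
    ⟨fun j hj e he => by
      obtain ⟨t, ht, rfl⟩ := Finset.mem_image.1 he
      exact hc.1 j hj t ht, fun j hj => by rw [hsum]; exact hc.2 j hj⟩
  refine ⟨g, hg, ?_⟩
  unfold IsCleanFor at hgc
  simp only [hsum] at hgc
  exact hgc

end

/-! ### Weak compactness and almost monotone subsequences -/

section

variable {X : Type*} [NormedAddCommGroup X] [NormedSpace ℝ X]

theorem IsWeaklyNull.tendsto_apply {x : ℕ → X} (hx : IsWeaklyNull x) (f : X →L[ℝ] ℝ) :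
    Tendsto (fun i => f (x i)) atTop (𝓝 0) := by
  have h := (WeakBilin.eval_continuous (topDualPairing ℝ X).flip f).tendsto 0
  have h0 : ((topDualPairing ℝ X).flip (0 : X)) f = 0 := by simp
  have h2 : Tendsto (fun i => f (x i)) atTop (𝓝 (((topDualPairing ℝ X).flip (0 : X)) f)) :=
    Tendsto.comp h hx
  rwa [h0] at h2

theorem IsWeaklyNull.comp {x : ℕ → X} (hx : IsWeaklyNull x) {m : ℕ → ℕ} (hm : StrictMono m) :
    IsWeaklyNull (x ∘ m) := 
  Filter.Tendsto.comp (g := fun i => toWeakSpace ℝ X (x i)) hx hm.tendsto_atTop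

/-- The sequences of values on `x` of the functionals of norm at most one. -/
def dualValues (x : ℕ → X) : Set (ℕ → ℝ) :=
  {c | ∃ f : X →L[ℝ] ℝ, ‖f‖ ≤ 1 ∧ ∀ i, c i = f (x i)}

/-- Banach–Alaoglu: the limit is given by the weak-star limit of the functionals along `U`. -/
theorem exists_dual_lim {x : ℕ → X} {U : Ultrafilter ℕ} (F : ℕ → ℕ → ℝ) (A : Set ℕ)
    (hA : A ∈ U) (hF : ∀ e ∈ A, F e ∈ dualValues x) :
    ∃ φ ∈ dualValues x, ∀ i, Tendsto (fun e => F e i) U (𝓝 (φ i)) := by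
  choose! f hf hfx using hF
  have hcomp := WeakDual.isCompact_closedBall (𝕜 := ℝ) (0 : StrongDual ℝ X) 1
  obtain ⟨g, hg, hlim⟩ := hcomp.ultrafilter_le_nhds
    (U.map fun e => StrongDual.toWeakDual (f e)) (by
      rw [Filter.le_principal_iff]
      exact Filter.mem_of_superset (f := (U : Filter ℕ)) hA fun e he => by simpa using hf e he)
  refine ⟨fun i => g (x i), ⟨WeakDual.toStrongDual g, by simpa using hg, fun i => rfl⟩, fun i => ?_⟩
  have h1 : Tendsto (fun e => StrongDual.toWeakDual (f e)) U (𝓝 g) := hlim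
  have h2 : Tendsto (fun e => (StrongDual.toWeakDual (f e)) (x i)) U (𝓝 (g (x i))) :=
    ((WeakDual.eval_continuous (x i)).tendsto g).comp h1
  refine h2.congr' ?_
  filter_upwards [hA] with e he
  exact (hfx e he i).symm

theorem isNullClosed_dualValues {x : ℕ → X} (hx : IsWeaklyNull x) {U : Ultrafilter ℕ}
    (hU : (U : Filter ℕ) ≤ atTop) : IsNullClosed U (dualValues x) where
  null := by
    rintro c ⟨f, -, hf⟩
    exact ((hx.tendsto_apply f).congr fun i => (hf i).symm).mono_left hU
  closed F φ A hA hF hφ := by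
    obtain ⟨ψ, hψ, hlim⟩ := exists_dual_lim F A hA hF
    have : φ = ψ := funext fun i => tendsto_nhds_unique (hφ i) (hlim i)
    exact this ▸ hψ
  exists_lim F A hA hF := by
    obtain ⟨ψ, -, hlim⟩ := exists_dual_lim F A hA hF
    exact ⟨ψ, hlim⟩

/-- Terms of a normalized weakly null sequence are eventually almost orthogonal to a given
finite-dimensional subspace. -/
theorem IsWeaklyNull.eventually_norm_le {x : ℕ → X} (hx : IsWeaklyNull x) (hx1 : ∀ i, ‖x i‖ = 1)
    (V : Submodule ℝ X) [FiniteDimensional ℝ V] {δ : ℝ} (hδ : 0 < δ) :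
    ∀ᶠ e in atTop, ∀ v ∈ V, ∀ t : ℝ, ‖v‖ ≤ (1 + δ) * ‖v + t • x e‖ := by
  obtain ⟨r, hr0, hr⟩ : ∃ r : ℝ, 0 < r ∧ 1 ≤ (1 + δ) * (1 - 3 * r) := by
    refine ⟨δ / (3 * (1 + δ)), by positivity, ?_⟩
    field_simp
    linarith
  have hcpt : IsCompact (Metric.sphere (0 : V) 1) := isCompact_sphere 0 1
  obtain ⟨S, hS, hcov⟩ := hcpt.elim_finite_subcover_image (b := Metric.sphere (0 : V) 1)
    (c := fun v => Metric.ball v r) (fun _ _ => Metric.isOpen_ball)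
    (fun v hv => Set.mem_iUnion₂.2 ⟨v, hv, Metric.mem_ball_self hr0⟩)
  have hf : ∀ v : V, ∃ f : X →L[ℝ] ℝ, ‖f‖ ≤ 1 ∧ f v = ‖(v : X)‖ := fun v => by
    obtain ⟨f, hf, hfv⟩ := exists_dual_vector'' ℝ (v : X)
    exact ⟨f, hf, by simpa using hfv⟩
  choose f hf1 hfv using hf
  have hev : ∀ᶠ e in atTop, ∀ v ∈ S, |f v (x e)| < r := by
    refine (hcov.1.eventually_all).2 fun v _ => ?_
    have := (hx.tendsto_apply (f v)).abs
    rw [abs_zero] at this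
    exact this.eventually_lt_const hr0
  filter_upwards [hev] with e he
  have key : ∀ v ∈ V, ‖v‖ = 1 → ∀ t : ℝ, 1 ≤ (1 + δ) * ‖v + t • x e‖ := by
    intro v hv hv1 t
    -- For small `t` a functional norming a nearby net point gives `1 - 3 * r`: one `r` from the
    -- net, two from `t • x e`. For large `t` the term `t • x e` dominates.
    rcases le_or_gt |t| 2 with ht | ht
    · have hmem : (⟨v, hv⟩ : V) ∈ Metric.sphere (0 : V) 1 := by simpa using hv1
      obtain ⟨w, hw, hvw⟩ := Set.mem_iUnion₂.1 (hcov.2 hmem)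
      have hw1 : ‖(w : X)‖ = 1 := by simpa using hS hw
      have hd : ‖v - w‖ < r := by
        have := Metric.mem_ball.1 hvw
        rw [Subtype.dist_eq, dist_eq_norm] at this
        exact this
      have h1 : f w (v + t • x e) = ‖(w : X)‖ + f w (v - w) + t * f w (x e) := by
        rw [← hfv w]
        simp only [map_add, map_sub, map_smul, smul_eq_mul]
        ring
      have h2 : |f w (v - w)| ≤ r := by
        calc |f w (v - w)| ≤ ‖f w‖ * ‖v - w‖ := (f w).le_opNorm _
          _ ≤ 1 * r := mul_le_mul (hf1 w) hd.le (norm_nonneg _) zero_le_one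
          _ = r := one_mul r
      have h3 : |t * f w (x e)| ≤ 2 * r := by
        rw [abs_mul]
        exact mul_le_mul ht (he w hw).le (abs_nonneg _) (by norm_num)
      have h4 : f w (v + t • x e) ≤ ‖v + t • x e‖ := by
        calc f w (v + t • x e) ≤ |f w (v + t • x e)| := le_abs_self _
          _ ≤ ‖f w‖ * ‖v + t • x e‖ := (f w).le_opNorm _
          _ ≤ 1 * ‖v + t • x e‖ := by gcongr; exact hf1 w
          _ = _ := one_mul _
      have h5 : 1 - 3 * r ≤ ‖v + t • x e‖ := by
        have := (abs_le.1 h2).1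
        have := (abs_le.1 h3).1
        linarith
      calc 1 ≤ (1 + δ) * (1 - 3 * r) := hr
        _ ≤ _ := by gcongr
    · have h1 : ‖t • x e‖ = |t| := by rw [norm_smul, hx1, mul_one, Real.norm_eq_abs]
      have h2 : ‖t • x e‖ - ‖v‖ ≤ ‖v + t • x e‖ := by
        have := norm_sub_norm_le (t • x e) (-v)
        rwa [norm_neg, sub_neg_eq_add, add_comm] at this
      rw [h1, hv1] at h2
      nlinarith
  intro v hv t
  by_cases hv0 : v = 0
  · subst hv0
    rw [norm_zero]
    positivity
  · have hn : ‖v‖ ≠ 0 := norm_ne_zero_iff.2 hv0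
    have h := key (‖v‖⁻¹ • v) (V.smul_mem _ hv) (by
      rw [norm_smul, norm_inv, norm_norm, inv_mul_cancel₀ hn]) (‖v‖⁻¹ * t)
    rw [mul_smul, ← smul_add, norm_smul, norm_inv, norm_norm] at h
    calc ‖v‖ = ‖v‖ * 1 := (mul_one _).symm
      _ ≤ ‖v‖ * ((1 + δ) * (‖v‖⁻¹ * ‖v + t • x e‖)) := by gcongr
      _ = _ := by field_simp

/-- Partial sums are dominated, up to the factor `C`, by longer sums. -/
def HasPartialSumBound (C : ℝ) (x : ℕ → X) : Prop :=
  ∀ (a : ℕ → ℝ) (k n : ℕ), k ≤ n →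
    ‖∑ i ∈ Finset.range k, a i • x i‖ ≤ C * ‖∑ i ∈ Finset.range n, a i • x i‖

/-- Mazur's construction: the losses `exp (L / 2 ^ (t + 1))` multiply to at most `exp L = 1 + δ`. -/
theorem exists_subsequence_hasPartialSumBound {x : ℕ → X} (hx : IsWeaklyNull x)
    (hx1 : ∀ i, ‖x i‖ = 1) {δ : ℝ} (hδ : 0 < δ) :
    ∃ m : ℕ → ℕ, StrictMono m ∧ HasPartialSumBound (1 + δ) (x ∘ m) := by
  set L := Real.log (1 + δ) with hL
  have hL0 : 0 < L := Real.log_pos (by linarith)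
  have step : ∀ (t : ℕ) (S : Finset ℕ) (n : ℕ), ∃ e, n < e ∧
      ∀ v ∈ Submodule.span ℝ (x '' S), ∀ s : ℝ,
        ‖v‖ ≤ Real.exp (L / 2 ^ (t + 1)) * ‖v + s • x e‖ := by
    intro t S n
    have : FiniteDimensional ℝ (Submodule.span ℝ (x '' S)) :=
      FiniteDimensional.span_of_finite ℝ (S.finite_toSet.image x)
    have hpos : 0 < Real.exp (L / 2 ^ (t + 1)) - 1 := by
      have : 0 < L / 2 ^ (t + 1) := by positivity
      linarith [Real.one_lt_exp_iff.2 this]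
    have h := hx.eventually_norm_le hx1 (Submodule.span ℝ (x '' S)) hpos
    simp only [add_sub_cancel] at h
    exact ((eventually_gt_atTop n).and h).exists
  choose nxt hnxt hnorm using step
  let seq : ℕ → Finset ℕ × ℕ := fun t => Nat.rec (motive := fun _ => Finset ℕ × ℕ) (∅, 0)
    (fun t q => (insert (nxt t q.1 q.2) q.1, nxt t q.1 q.2)) t
  set m : ℕ → ℕ := fun t => (seq (t + 1)).2 with hm
  have hmem : ∀ t, ∀ i < t, m i ∈ (seq t).1 := by
    intro t
    induction t with
    | zero => intro i hi; omega
    | succ t ih =>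
      intro i hi
      rcases (Nat.lt_succ_iff_lt_or_eq.1 hi) with h | rfl
      · exact Finset.mem_insert_of_mem (ih i h)
      · exact Finset.mem_insert_self _ _
  refine ⟨m, strictMono_nat_of_lt_succ fun t => hnxt _ _ _, fun a k n hkn => ?_⟩
  have hsucc : ∀ n, ‖∑ i ∈ Finset.range n, a i • (x ∘ m) i‖ ≤
      Real.exp (L / 2 ^ (n + 1)) * ‖∑ i ∈ Finset.range (n + 1), a i • (x ∘ m) i‖ := by
    intro n
    rw [Finset.sum_range_succ]
    refine hnorm n (seq n).1 (seq n).2 _ (Submodule.sum_mem _ fun i hi => ?_) (a n)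
    exact Submodule.smul_mem _ _ (Submodule.subset_span ⟨m i, hmem n i (Finset.mem_range.1 hi), rfl⟩)
  have key : ‖∑ i ∈ Finset.range k, a i • (x ∘ m) i‖ ≤
      Real.exp (L / 2 ^ k - L / 2 ^ n) * ‖∑ i ∈ Finset.range n, a i • (x ∘ m) i‖ := by
    induction n, hkn using Nat.le_induction with
    | base => simp
    | succ n hkn ih =>
      refine ih.trans ?_
      have h : L / 2 ^ k - L / 2 ^ (n + 1) = (L / 2 ^ k - L / 2 ^ n) + L / 2 ^ (n + 1) := by
        rw [pow_succ]; ring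
      rw [h, Real.exp_add, mul_assoc]
      gcongr
      exact hsucc n
  refine key.trans ?_
  gcongr
  rw [← Real.le_log_iff_exp_le (by positivity)]
  have h1 : L / 2 ^ k ≤ L := div_le_self hL0.le (one_le_pow₀ (by norm_num))
  have h2 : 0 ≤ L / 2 ^ n := by positivity
  linarith

end

/-! ### Basic sequences from partial sum bounds -/

section

variable {X : Type*} [NormedAddCommGroup X] [NormedSpace ℝ X]

theorem HasPartialSumBound.comp {C : ℝ} {x : ℕ → X} (h : HasPartialSumBound C x) {m : ℕ → ℕ}
    (hm : StrictMono m) : HasPartialSumBound C (x ∘ m) := by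
  classical
  intro a k n hkn
  set b : ℕ → ℝ := fun i => if hi : ∃ t, m t = i then a hi.choose else 0 with hb
  have hbm : ∀ t, b (m t) = a t := by
    intro t
    have hi : ∃ s, m s = m t := ⟨t, rfl⟩
    simp only [hb, dif_pos hi]
    rw [hm.injective hi.choose_spec]
  have key : ∀ n, ∑ i ∈ Finset.range n, a i • (x ∘ m) i = ∑ i ∈ Finset.range (m n), b i • x i := by
    intro n
    have himg : ∑ i ∈ Finset.range n, a i • (x ∘ m) i =
        ∑ i ∈ (Finset.range n).image m, b i • x i := by
      rw [Finset.sum_image hm.injective.injOn]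
      exact Finset.sum_congr rfl fun t _ => by rw [hbm]; rfl
    rw [himg]
    refine Finset.sum_subset ?_ ?_
    · intro i hi
      obtain ⟨t, ht, rfl⟩ := Finset.mem_image.1 hi
      exact Finset.mem_range.2 (hm (Finset.mem_range.1 ht))
    · intro i hi hi'
      have : ¬ ∃ t, m t = i := by
        rintro ⟨t, rfl⟩
        exact hi' (Finset.mem_image_of_mem _
          (Finset.mem_range.2 (hm.lt_iff_lt.1 (Finset.mem_range.1 hi))))
      simp only [hb, dif_neg this, zero_smul]
  rw [key, key]
  exact h b _ _ (hm.monotone hkn)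

theorem HasPartialSumBound.one_le {C : ℝ} {x : ℕ → X} (h : HasPartialSumBound C x)
    (hx : ∀ i, x i ≠ 0) : 1 ≤ C := by
  have h1 := h (fun _ => 1) 1 1 le_rfl
  simp only [Finset.range_one, one_smul, Finset.sum_singleton] at h1
  have h0 : 0 < ‖x 0‖ := norm_pos_iff.2 (hx 0)
  by_contra hc
  push Not at hc
  nlinarith

theorem HasPartialSumBound.norm_term_le {C : ℝ} {x : ℕ → X} (h : HasPartialSumBound C x)
    (a : ℕ → ℝ) {k n : ℕ} (hkn : k < n) :
    ‖a k • x k‖ ≤ 2 * C * ‖∑ i ∈ Finset.range n, a i • x i‖ := by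
  have h1 := h a (k + 1) n hkn
  have h2 := h a k n hkn.le
  have h3 : a k • x k = ∑ i ∈ Finset.range (k + 1), a i • x i - ∑ i ∈ Finset.range k, a i • x i := by
    rw [Finset.sum_range_succ, add_sub_cancel_left]
  rw [h3]
  linarith [norm_sub_le (∑ i ∈ Finset.range (k + 1), a i • x i) (∑ i ∈ Finset.range k, a i • x i)]

theorem sum_range_eq_sum_support (a : ℕ →₀ ℝ) (x : ℕ → X) {n : ℕ}
    (hn : a.support ⊆ Finset.range n) :
    ∑ i ∈ Finset.range n, a i • x i = ∑ i ∈ a.support, a i • x i := by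
  symm
  refine Finset.sum_subset hn fun i _ hi => ?_
  rw [Finsupp.notMem_support_iff.1 hi, zero_smul]

theorem exists_support_subset_range (a : ℕ →₀ ℝ) (k : ℕ) :
    ∃ n, k < n ∧ a.support ⊆ Finset.range n := by
  refine ⟨max (k + 1) (a.support.sup id + 1), by omega, fun i hi => ?_⟩
  have := Finset.le_sup (f := id) hi
  simp only [id] at this
  exact Finset.mem_range.2 (by omega)

theorem HasPartialSumBound.linearIndependent {C : ℝ} {x : ℕ → X} (h : HasPartialSumBound C x)
    (hx : ∀ i, x i ≠ 0) : LinearIndependent ℝ x := by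
  rw [linearIndependent_iff]
  intro a ha
  ext k
  obtain ⟨n, hkn, hn⟩ := exists_support_subset_range a k
  have h1 := h.norm_term_le a hkn
  rw [sum_range_eq_sum_support a x hn] at h1
  have h2 : ∑ i ∈ a.support, a i • x i = 0 := ha
  rw [h2, norm_zero, mul_zero, norm_le_zero_iff, smul_eq_zero] at h1
  exact h1.resolve_right (hx k)

/-- Nonzero vectors with uniformly bounded partial sums form a basic sequence. -/
theorem HasPartialSumBound.isBasicSequenceWith {C : ℝ} {x : ℕ → X} (h : HasPartialSumBound C x)
    (hx : ∀ i, x i ≠ 0) : IsBasicSequenceWith C x := by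
  have hC := h.one_le hx
  have hL := h.linearIndependent hx
  set V := Submodule.span ℝ (Set.range x) with hV
  have hrepr : ∀ (v : V) (k : ℕ), ∃ n, k < n ∧ (∀ i ≥ n, hL.repr v i = 0) ∧
      (v : X) = ∑ i ∈ Finset.range n, hL.repr v i • x i := by
    intro v k
    obtain ⟨n, hkn, hn⟩ := exists_support_subset_range (hL.repr v) k
    refine ⟨n, hkn, fun i hi => ?_, ?_⟩
    · by_contra hc
      have := Finset.mem_range.1 (hn (Finsupp.mem_support_iff.2 hc))
      omega
    · rw [sum_range_eq_sum_support _ _ hn]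
      exact (hL.linearCombination_repr v).symm
  -- Extending the coordinates to all of `X` by Hahn–Banach makes them available on the closure of
  -- the span, where bounds and convergence follow by density.
  have hcoord : ∀ k, ∃ g : X →L[ℝ] ℝ, ∀ v : V, g v = hL.repr v k := by
    intro k
    let f : V →ₗ[ℝ] ℝ := (Finsupp.lapply k).comp hL.repr
    have hf : ∀ v : V, ‖f v‖ ≤ (2 * C * ‖x k‖⁻¹) * ‖v‖ := by
      intro v
      obtain ⟨n, hkn, -, hv⟩ := hrepr v k
      have h1 := h.norm_term_le (hL.repr v) hkn
      rw [← hv, norm_smul] at h1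
      have h0 : 0 < ‖x k‖ := norm_pos_iff.2 (hx k)
      have h2 : ‖f v‖ ≤ 2 * C * ‖(v : X)‖ / ‖x k‖ := (le_div_iff₀ h0).2 h1
      calc ‖f v‖ ≤ 2 * C * ‖(v : X)‖ / ‖x k‖ := h2
        _ = _ := by rw [Submodule.coe_norm]; field_simp
    obtain ⟨g, hg, -⟩ := exists_extension_norm_eq V (f.mkContinuous _ hf)
    exact ⟨g, hg⟩
  choose g hg using hcoord
  let Q : ℕ → X →L[ℝ] X := fun n => ∑ i ∈ Finset.range n, (g i).smulRight (x i)
  have hQ : ∀ n v, Q n v = ∑ i ∈ Finset.range n, g i v • x i := by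
    intro n v
    simp [Q, ContinuousLinearMap.smulRight_apply]
  have hQV : ∀ (n : ℕ) (v : V), ‖Q n v‖ ≤ C * ‖(v : X)‖ := by
    intro n v
    obtain ⟨N, hN, -, hv⟩ := hrepr v n
    rw [hQ]
    simp only [hg]
    conv_rhs => rw [hv]
    exact h _ _ _ hN.le
  set Y := V.topologicalClosure with hY
  have hQY : ∀ (n : ℕ), ∀ v ∈ Y, ‖Q n v‖ ≤ C * ‖v‖ := by
    intro n v hv
    have hcl : IsClosed {v : X | ‖Q n v‖ ≤ C * ‖v‖} :=
      isClosed_le (Q n).continuous.norm (continuous_const.mul continuous_norm)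
    exact closure_minimal (fun w hw => hQV n ⟨w, hw⟩) hcl hv
  have hconv : ∀ v ∈ Y, Tendsto (fun n => Q n v) atTop (𝓝 v) := by
    intro v hv
    rw [Metric.tendsto_atTop]
    intro ε hε
    have hv' : v ∈ closure (V : Set X) := hv
    obtain ⟨w, hw, hvw⟩ := Metric.mem_closure_iff.1 hv' (ε / (C + 1)) (by positivity)
    obtain ⟨N, -, hN, hwN⟩ := hrepr ⟨w, hw⟩ 0
    refine ⟨N, fun n hn => ?_⟩
    have hQw : Q n w = w := by
      rw [hQ]
      have : ∀ i, g i w = hL.repr ⟨w, hw⟩ i := fun i => hg i ⟨w, hw⟩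
      simp only [this]
      rw [← Finset.sum_subset (Finset.range_mono hn) fun i _ hi => by
        rw [hN i (by simpa using hi), zero_smul]]
      exact hwN.symm
    have h1 : Q n v - v = Q n (v - w) - (v - w) := by rw [map_sub, hQw]; abel
    have h2 := hQY n (v - w) (Y.sub_mem hv (V.le_topologicalClosure hw))
    rw [dist_eq_norm, h1]
    rw [dist_eq_norm, lt_div_iff₀ (by positivity)] at hvw
    have := norm_sub_le (Q n (v - w)) (v - w)
    linarith
  have hxY : ∀ i, x i ∈ Y := fun i => V.le_topologicalClosure (Submodule.subset_span ⟨i, rfl⟩)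
  let b : SchauderBasis ℝ Y :=
    { basis := fun i => ⟨x i, hxY i⟩
      coord := fun i => (g i).comp Y.subtypeL
      ortho := by
        intro i j
        have h1 : g i (x j) = hL.repr ⟨x j, Submodule.subset_span ⟨j, rfl⟩⟩ i := hg i ⟨x j, _⟩
        rw [hL.repr_eq_single j _ rfl] at h1
        change g i (x j) = _
        rw [h1, Finsupp.single_eq_pi_single]
        convert rfl
      expansion := by
        intro v
        unfold HasSum
        rw [SummationFilter.conditional_filter_eq_map_range, tendsto_map'_iff]
        rw [tendsto_subtype_rng]
        refine (hconv v v.2).congr fun n => ?_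
        rw [hQ]
        simp }
  refine ⟨b, fun i => rfl, fun n => ?_⟩
  refine ContinuousLinearMap.opNorm_le_bound _ (by linarith) fun v => ?_
  have : ((b.proj n v : Y) : X) = Q n v := by
    rw [hQ, SchauderBasis.proj_apply]
    simp [b]
  rw [Submodule.coe_norm, this]
  exact hQY n v v.2

theorem IsBasicSequenceWith.mono {C C' : ℝ} {x : ℕ → X} (h : IsBasicSequenceWith C x)
    (hC : C ≤ C') : IsBasicSequenceWith C' x :=
  let ⟨b, hb, hn⟩ := h
  ⟨b, hb, fun n => (hn n).trans hC⟩

theorem IsBasicSequenceWith.isBasicSequence {C : ℝ} {x : ℕ → X} (h : IsBasicSequenceWith C x) :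
    IsBasicSequence x :=
  let ⟨b, hb, _⟩ := h
  ⟨b, hb⟩

end

/-! ### Weighted masses, finite grids of patterns and the cutoff -/

/-- On a piece, positive values of `g` count at least with weight `b j`; negative values and fillers
cost at most `A` times their size, `A * P.err` in total. -/
theorem IsCleanFor.exists_le_sum {P : Pattern} {G : ℕ → Finset ℕ} {W : Finset ℕ} {g : ℕ → ℝ}
    (hc : IsCleanFor P (W \ (Finset.range P.size).biUnion G) G g) (hGW : ∀ j, G j ⊆ W)
    (hdisj : ∀ i j, i ≠ j → Disjoint (G i) (G j)) {a b : ℕ → ℝ} {A : ℝ} (hA : 0 ≤ A)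
    (haA : ∀ i, |a i| ≤ A) (hb : ∀ j, 0 ≤ b j) (hba : ∀ j, ∀ i ∈ G j, b j ≤ a i) :
    ∃ J ∈ P.suff, J ⊆ Finset.range P.size ∧
      ∑ j ∈ J, b j * (P.mass j - P.err) - A * P.err ≤ ∑ i ∈ W, a i * g i := by
  obtain ⟨hsmall, J, hJ, hJr, hmass⟩ := hc
  refine ⟨J, hJ, hJr, ?_⟩
  have hsub : (Finset.range P.size).biUnion G ⊆ W := Finset.biUnion_subset.2 fun j _ => hGW j
  rw [← Finset.sum_sdiff hsub, Finset.sum_biUnion fun i _ j _ hij => hdisj i j hij]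
  have h1 : -(A * ∑ i ∈ W \ (Finset.range P.size).biUnion G, |g i|) ≤
      ∑ i ∈ W \ (Finset.range P.size).biUnion G, a i * g i := by
    rw [Finset.mul_sum, ← Finset.sum_neg_distrib]
    refine Finset.sum_le_sum fun i _ => ?_
    have : |a i * g i| ≤ A * |g i| := by
      rw [abs_mul]
      gcongr
      exact haA i
    linarith [neg_abs_le (a i * g i)]
  have h2 : ∀ j, ∀ i ∈ G j, b j * g i - A * max (-g i) 0 ≤ a i * g i := by
    intro j i hi
    have hbi := hba j i hi
    have hAi := (le_abs_self _).trans (haA i)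
    have hb0 := hb j
    rcases le_total 0 (g i) with h | h
    · rw [max_eq_right (by linarith)]
      nlinarith
    · rw [max_eq_left (by linarith)]
      nlinarith
  have h3 : ∀ j, b j * ∑ i ∈ G j, g i - A * ∑ i ∈ G j, max (-g i) 0 ≤ ∑ i ∈ G j, a i * g i := by
    intro j
    rw [Finset.mul_sum, Finset.mul_sum, ← Finset.sum_sub_distrib]
    exact Finset.sum_le_sum (h2 j)
  have h4 : ∀ j, -(A * ∑ i ∈ G j, max (-g i) 0) ≤ ∑ i ∈ G j, a i * g i := by
    intro j
    rw [Finset.mul_sum, ← Finset.sum_neg_distrib]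
    refine Finset.sum_le_sum fun i hi => ?_
    have hbi := hba j i hi
    have hAi := (le_abs_self _).trans (haA i)
    have hb0 := hb j
    rcases le_total 0 (g i) with h | h
    · rw [max_eq_right (by linarith)]
      nlinarith
    · rw [max_eq_left (by linarith)]
      nlinarith
  have h5 : ∑ j ∈ J, b j * (P.mass j - P.err) -
      A * ∑ j ∈ Finset.range P.size, ∑ i ∈ G j, max (-g i) 0 ≤
      ∑ j ∈ Finset.range P.size, ∑ i ∈ G j, a i * g i := by
    rw [Finset.mul_sum, ← Finset.sum_sdiff hJr (f := fun j => A * _),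
      ← Finset.sum_sdiff hJr (f := fun j => ∑ i ∈ G j, a i * g i)]
    have e1 : -∑ j ∈ Finset.range P.size \ J, A * ∑ i ∈ G j, max (-g i) 0 ≤
        ∑ j ∈ Finset.range P.size \ J, ∑ i ∈ G j, a i * g i := by
      rw [← Finset.sum_neg_distrib]
      exact Finset.sum_le_sum fun j _ => h4 j
    have e2 : ∑ j ∈ J, b j * (P.mass j - P.err) - ∑ j ∈ J, A * ∑ i ∈ G j, max (-g i) 0 ≤
        ∑ j ∈ J, ∑ i ∈ G j, a i * g i := by
      rw [← Finset.sum_sub_distrib]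
      refine Finset.sum_le_sum fun j hj => ?_
      have := mul_le_mul_of_nonneg_left (hmass j hj) (hb j)
      linarith [h3 j]
    linarith
  have h6 := mul_le_mul_of_nonneg_left hsmall hA
  rw [mul_add] at h6
  linarith

/-- The precision of the patterns used from time `k` on. -/
def patternErr (D δ : ℝ) (k : ℕ) : ℝ := δ / ((k + 1) * D)

/-- The bound for the total mass of the patterns used from time `k` on. -/
def massBound (D δ : ℝ) (k : ℕ) : ℝ := (k + 1) * D / δ

/-- The number of steps of size `patternErr D δ k` below `massBound D δ k`. -/
def massSteps (D δ : ℝ) (k : ℕ) : ℕ := ⌈massBound D δ k / patternErr D δ k⌉₊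

/-- The pattern with masses `t j * patternErr D δ k`. -/
def gridPattern (D δ : ℝ) (k : ℕ) (t : Fin (k + 1) → Fin (massSteps D δ k + 1))
    (S : Set (Finset ℕ)) : Pattern where
  size := k + 1
  err := patternErr D δ k
  mass j := if hj : j < k + 1 then (t ⟨j, hj⟩ : ℕ) * patternErr D δ k else 0
  suff := S

/-- The finitely many patterns used from time `k` on. -/
def gridPatterns (D δ : ℝ) (k : ℕ) : Set Pattern :=
  {P | (∃ t, ∃ S ∈ 𝒫 (((Finset.range (k + 1)).powerset : Finset (Finset ℕ)) : Set (Finset ℕ)),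
      gridPattern D δ k t S = P) ∧
    ∀ J ⊆ Finset.range P.size, J ∈ P.suff ∨ Finset.range P.size \ J ∈ P.suff}

theorem finite_gridPatterns (D δ : ℝ) (k : ℕ) : (gridPatterns D δ k).Finite := by
  have hfin : (𝒫 (((Finset.range (k + 1)).powerset : Finset (Finset ℕ)) :
      Set (Finset ℕ))).Finite := (Finset.finite_toSet _).powerset
  refine (Set.finite_iUnion fun t : Fin (k + 1) → Fin (massSteps D δ k + 1) =>
    hfin.image (gridPattern D δ k t)).subset ?_
  rintro P ⟨⟨t, S, hS, rfl⟩, -⟩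
  exact Set.mem_iUnion.2 ⟨t, S, hS, rfl⟩

theorem patternErr_pos {D δ : ℝ} (hD : 1 ≤ D) (hδ : 0 < δ) (k : ℕ) : 0 < patternErr D δ k := by
  unfold patternErr
  positivity

theorem patternErr_le {D δ : ℝ} (hD : 1 ≤ D) (hδ : 0 < δ) (k : ℕ) : patternErr D δ k ≤ δ := by
  refine div_le_self hδ.le ?_
  have : (0 : ℝ) ≤ k := k.cast_nonneg
  nlinarith

theorem mul_patternErr {D δ : ℝ} (hD : 1 ≤ D) (k : ℕ) :
    (k + 1) * D * patternErr D δ k = δ := by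
  unfold patternErr
  field_simp

/-- The masses are rounded down to the grid. The real weights `b` enter only through the family of
sets with at least half of the weighted mass, so finitely many patterns cover all weights. -/
theorem exists_gridPattern {D δ : ℝ} (hD : 1 ≤ D) (hδ : 0 < δ) (k : ℕ) (μ b : ℕ → ℝ)
    (hμ0 : ∀ j, 0 ≤ μ j) (hμ : ∀ j, μ j ≤ massBound D δ k) :
    ∃ P ∈ gridPatterns D δ k, P.size = k + 1 ∧ P.err = patternErr D δ k ∧
      (∀ j < k + 1, P.mass j ≤ μ j ∧ μ j ≤ P.mass j + patternErr D δ k) ∧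
      ∀ J ∈ P.suff, ∑ j ∈ Finset.range (k + 1), b j * P.mass j ≤ 2 * ∑ j ∈ J, b j * P.mass j := by
  have he := patternErr_pos hD hδ k
  have ht : ∀ j, ⌊μ j / patternErr D δ k⌋₊ < massSteps D δ k + 1 := by
    intro j
    refine Nat.lt_succ_of_le ((Nat.floor_le_floor ?_).trans (Nat.floor_le_ceil _))
    gcongr
    exact hμ j
  set t : Fin (k + 1) → Fin (massSteps D δ k + 1) := fun j => ⟨⌊μ j / patternErr D δ k⌋₊, ht j⟩
  set s : ℕ → ℝ := (gridPattern D δ k t ∅).mass with hs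
  set S : Set (Finset ℕ) := {J | J ⊆ Finset.range (k + 1) ∧
    ∑ j ∈ Finset.range (k + 1), b j * s j ≤ 2 * ∑ j ∈ J, b j * s j}
  refine ⟨gridPattern D δ k t S, ⟨⟨t, S, fun J hJ => ?_, rfl⟩, fun J hJ => ?_⟩, rfl, rfl,
    fun j hj => ?_, fun J hJ => hJ.2⟩
  · exact Finset.mem_coe.2 (Finset.mem_powerset.2 hJ.1)
  · replace hJ : J ⊆ Finset.range (k + 1) := hJ
    have hsum := Finset.sum_sdiff (f := fun j => b j * s j) hJ
    rcases le_total (∑ j ∈ Finset.range (k + 1), b j * s j) (2 * ∑ j ∈ J, b j * s j) with h | h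
    · exact Or.inl ⟨hJ, h⟩
    · refine Or.inr ⟨Finset.sdiff_subset, ?_⟩
      change _ ≤ 2 * ∑ j ∈ Finset.range (k + 1) \ J, b j * s j
      linarith
  · have hm : (gridPattern D δ k t S).mass j =
        (⌊μ j / patternErr D δ k⌋₊ : ℝ) * patternErr D δ k := dif_pos hj
    rw [hm]
    constructor
    · rw [← le_div_iff₀ he]
      exact Nat.floor_le (div_nonneg (hμ0 j) he.le)
    · have := (Nat.lt_floor_add_one (μ j / patternErr D δ k)).le
      rw [div_le_iff₀ he] at this
      linarith

theorem abs_le_of_osc_le {a : ℕ →₀ ℝ} {E : Finset ℕ} {D : ℝ} (h : osc a E ≤ D) {i j : ℕ}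
    (hi : i ∈ E) (hj : j ∈ E) (haj : a j ≠ 0) : |a i| ≤ D * |a j| := by
  have hbdd : BddAbove {r : ℝ | ∃ i ∈ (E : Set ℕ), ∃ j ∈ (E : Set ℕ), a j ≠ 0 ∧
      r = |a i| / |a j|} := by
    refine Set.Finite.bddAbove (((E ×ˢ E).finite_toSet.image
      fun q : ℕ × ℕ => |a q.1| / |a q.2|).subset ?_)
    rintro r ⟨i, hi, j, hj, -, rfl⟩
    exact ⟨(i, j), by simpa using ⟨hi, hj⟩, rfl⟩
  have h1 : |a i| / |a j| ≤ osc a E := le_csSup hbdd ⟨i, hi, j, hj, haj, rfl⟩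
  exact (div_le_iff₀ (abs_pos.2 haj)).1 (h1.trans h)

/-- A set of points with bounded weights can be cut off at a time from which on the patterns cover
its mass, losing little of the weighted mass. -/
theorem exists_cutoff {D δ : ℝ} (hD : 1 ≤ D) (hδ : 0 < δ) {E : Finset ℕ} {a φ : ℕ → ℝ} {n : ℕ}
    (hn : ∀ i ∈ E, n ≤ i + 1) (ha : ∀ i ∈ E, 0 < a i) (haD : ∀ i ∈ E, ∀ j ∈ E, a i ≤ D * a j)
    (hφ0 : ∀ i ∈ E, 0 ≤ φ i) (hφ1 : ∀ i, φ i ≤ 1) :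
    ∃ k, n ≤ k + 1 ∧ ∑ i ∈ E, φ i ≤ massBound D δ k ∧
      (1 - δ) * ∑ i ∈ E, a i * φ i ≤ ∑ i ∈ E with k ≤ i, a i * φ i := by
  classical
  have hex : ∃ k, n ≤ k + 1 ∧ ∑ i ∈ E, φ i ≤ massBound D δ k := by
    obtain ⟨k, hk⟩ := exists_nat_ge (δ * (∑ i ∈ E, φ i))
    refine ⟨max n k, by omega, ?_⟩
    unfold massBound
    rw [le_div_iff₀ hδ, mul_comm]
    have h1 : (k : ℝ) ≤ (max n k : ℕ) := by exact_mod_cast le_max_right _ _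
    have h2 : (0 : ℝ) ≤ (max n k : ℕ) := Nat.cast_nonneg _
    nlinarith
  refine ⟨Nat.find hex, (Nat.find_spec hex).1, (Nat.find_spec hex).2, ?_⟩
  set k := Nat.find hex with hk
  have hsplit := Finset.sum_filter_add_sum_filter_not E (fun i => k ≤ i) fun i => a i * φ i
  have hnonneg : ∀ i ∈ E, 0 ≤ a i * φ i := fun i hi => mul_nonneg (ha i hi).le (hφ0 i hi)
  suffices h : ∑ i ∈ E with ¬ k ≤ i, a i * φ i ≤ δ * ∑ i ∈ E, a i * φ i by linarith
  rcases Finset.eq_empty_or_nonempty (E.filter fun i => ¬ k ≤ i) with he | ⟨i₁, hi₁⟩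
  · rw [he, Finset.sum_empty]
    exact mul_nonneg hδ.le (Finset.sum_nonneg hnonneg)
  obtain ⟨hi₁E, hi₁k⟩ := Finset.mem_filter.1 hi₁
  obtain ⟨i₀, hi₀, hmin⟩ := Finset.exists_min_image E a ⟨i₁, hi₁E⟩
  have hβ := ha i₀ hi₀
  -- A point of `E` below `k` forces `n ≤ k = l + 1` by the Schreier condition. So `l` fails only
  -- because the mass exceeds `(l + 1) * D / δ`, which makes the at most `l + 1` lost points, each
  -- of weight at most `D * a i₀`, negligible.
  obtain ⟨l, hl⟩ : ∃ l, k = l + 1 := ⟨k - 1, by omega⟩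
  have hnot := Nat.find_min hex (show l < Nat.find hex by omega)
  have hmass : massBound D δ l < ∑ i ∈ E, φ i := by
    by_contra hc
    have := hn i₁ hi₁E
    exact hnot ⟨by omega, not_lt.1 hc⟩
  have h1 : ∑ i ∈ E with ¬ k ≤ i, a i * φ i ≤ ∑ i ∈ Finset.range k, D * a i₀ := by
    calc ∑ i ∈ E with ¬ k ≤ i, a i * φ i ≤ ∑ i ∈ E with ¬ k ≤ i, D * a i₀ := by
          refine Finset.sum_le_sum fun i hi => ?_
          have hiE := (Finset.mem_filter.1 hi).1
          calc a i * φ i ≤ a i * 1 := mul_le_mul_of_nonneg_left (hφ1 i) (ha i hiE).le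
            _ = a i := mul_one _
            _ ≤ _ := haD i hiE i₀ hi₀
      _ ≤ _ := by
          refine Finset.sum_le_sum_of_subset_of_nonneg (fun i hi => ?_) fun _ _ _ => by positivity
          exact Finset.mem_range.2 (not_le.1 (Finset.mem_filter.1 hi).2)
  rw [Finset.sum_const, Finset.card_range, nsmul_eq_mul] at h1
  have h2 : a i₀ * ∑ i ∈ E, φ i ≤ ∑ i ∈ E, a i * φ i := by
    rw [Finset.mul_sum]
    exact Finset.sum_le_sum fun i hi => mul_le_mul_of_nonneg_right (hmin i hi) (hφ0 i hi)
  unfold massBound at hmass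
  rw [div_lt_iff₀ hδ] at hmass
  have h3 : (k : ℝ) = l + 1 := by rw [hl]; push_cast; ring
  rw [h3] at h1
  calc _ ≤ (l + 1) * (D * a i₀) := h1
    _ = ((l + 1) * D) * a i₀ := by ring
    _ ≤ ((∑ i ∈ E, φ i) * δ) * a i₀ := by gcongr
    _ = δ * (a i₀ * ∑ i ∈ E, φ i) := by ring
    _ ≤ _ := by gcongr

/-! ### The inequality for sequences with clean functionals -/

section

variable {X : Type*} [NormedAddCommGroup X] [NormedSpace ℝ X]

/-- Functionals carrying a grid pattern on successive sets can be replaced by functionals that are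
small outside these sets. -/
def HasCleanFunctionals (D δ : ℝ) (z : ℕ → X) : Prop :=
  ∀ k, ∀ P ∈ gridPatterns D δ k, ∀ T ≥ k, ∀ G : ℕ → Finset ℕ,
    (∀ j, G j ⊆ Finset.Ico k T) → (∀ j ≥ P.size, G j = ∅) →
    (∀ i j, i < j → ∀ p ∈ G i, ∀ q ∈ G j, p < q) →
    ∀ f : X →L[ℝ] ℝ, ‖f‖ ≤ 1 → Carries P G (fun i => f (z i)) →
      ∃ g : X →L[ℝ] ℝ, ‖g‖ ≤ 1 ∧
        IsCleanFor P (Finset.Ico k T \ (Finset.range P.size).biUnion G) G (fun i => g (z i))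

theorem exists_subsequence_hasCleanFunctionals {x : ℕ → X} (hx : IsWeaklyNull x) {D δ : ℝ}
    (hD : 1 ≤ D) (hδ : 0 < δ) :
    ∃ m : ℕ → ℕ, StrictMono m ∧ HasCleanFunctionals D δ (x ∘ m) := by
  have hU : ((hyperfilter ℕ : Ultrafilter ℕ) : Filter ℕ) ≤ atTop := Nat.hyperfilter_le_atTop
  obtain ⟨m, hm, h⟩ := exists_subsequence_clean hU (isNullClosed_dualValues hx hU)
    (gridPatterns D δ) (finite_gridPatterns D δ) (by
      rintro k P ⟨⟨t, S, -, rfl⟩, hS⟩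
      exact ⟨patternErr_pos hD hδ k, hS⟩)
  refine ⟨m, hm, fun k P hP T hT G h1 h2 h3 f hf hc => ?_⟩
  obtain ⟨_, ⟨g, hg, hgx⟩, hclean⟩ := h k P hP T hT G h1 h2 h3 (fun i => f (x i))
    ⟨f, hf, fun _ => rfl⟩ hc
  refine ⟨g, hg, ?_⟩
  convert hclean using 1
  funext i
  exact (hgx (m i)).symm

/-- After the cutoff, `f` is matched with a grid pattern and exchanged for a clean `g`, which is
tested on the tail from `k` on. In `4`, one factor 2 is the half of the mass kept and the other the
norm of the tail. -/
theorem HasCleanFunctionals.sum_le {D d δ : ℝ} (hD : 1 ≤ D) (hd : 1 ≤ d) (hδ : 0 < δ) (hδ1 : δ ≤ 1)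
    {z : ℕ → X} (hz : ∀ i, ‖z i‖ = 1) (hP : HasPartialSumBound (1 + δ) z)
    (hc : HasCleanFunctionals D δ z) (a : ℕ →₀ ℝ) {n : ℕ} {F : ℕ → Finset ℕ}
    (hF0 : ∀ j ≥ n, F j = ∅) (hFs : ∀ i j, i < j → ∀ p ∈ F i, ∀ q ∈ F j, p < q)
    (hn : ∀ j, ∀ i ∈ F j, n ≤ i + 1) (hpos : ∀ j, ∀ i ∈ F j, 0 < a i)
    (haD : ∀ j j', ∀ i ∈ F j, ∀ i' ∈ F j', a i ≤ D * a i')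
    (had : ∀ j, ∀ i ∈ F j, ∀ i' ∈ F j, a i ≤ d * a i')
    {f : X →L[ℝ] ℝ} (hf : ‖f‖ ≤ 1) (hf0 : ∀ j, ∀ i ∈ F j, 0 ≤ f (z i)) :
    (1 - δ) * ∑ i ∈ (Finset.range n).biUnion F, a i * f (z i) ≤
      d * (4 + 22 * δ) * ‖∑ i ∈ a.support, a i • z i‖ := by
  classical
  set v := ∑ i ∈ a.support, a i • z i with hv
  set E := (Finset.range n).biUnion F with hE
  have hdisj : ∀ i j, i ≠ j → ∀ p ∈ F i, p ∉ F j := by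
    intro i j hij p hi hj
    rcases lt_or_gt_of_ne hij with h | h
    · exact lt_irrefl _ (hFs i j h p hi p hj)
    · exact lt_irrefl _ (hFs j i h p hj p hi)
  have hmemE : ∀ i, i ∈ E ↔ ∃ j, i ∈ F j := by
    intro i
    simp only [hE, Finset.mem_biUnion, Finset.mem_range]
    refine ⟨fun ⟨j, _, h⟩ => ⟨j, h⟩, fun ⟨j, h⟩ => ⟨j, ?_, h⟩⟩
    by_contra hj
    simp [hF0 j (not_lt.1 hj)] at h
  have hle : ∀ g : X →L[ℝ] ℝ, ‖g‖ ≤ 1 → ∀ w, g w ≤ ‖w‖ := fun g hg w => by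
    calc g w ≤ |g w| := le_abs_self _
      _ ≤ ‖g‖ * ‖w‖ := g.le_opNorm w
      _ ≤ 1 * ‖w‖ := by gcongr
      _ = _ := one_mul _
  rcases Finset.eq_empty_or_nonempty E with hE0 | hEne
  · rw [hE0]
    simp only [Finset.sum_empty, mul_zero]
    positivity
  obtain ⟨i₀, hi₀, hmin⟩ := Finset.exists_min_image E a hEne
  obtain ⟨j₀, hij₀⟩ := (hmemE i₀).1 hi₀
  have hβ : 0 < a i₀ := hpos j₀ i₀ hij₀
  obtain ⟨k, hnk, hmass, hcut⟩ := exists_cutoff (a := a) (φ := fun i => f (z i)) hD hδ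
    (fun i hi => let ⟨j, h⟩ := (hmemE i).1 hi; hn j i h)
    (fun i hi => let ⟨j, h⟩ := (hmemE i).1 hi; hpos j i h)
    (fun i hi i' hi' => let ⟨j, h⟩ := (hmemE i).1 hi; let ⟨j', h'⟩ := (hmemE i').1 hi'
      haD j j' i h i' h')
    (fun i hi => let ⟨j, h⟩ := (hmemE i).1 hi; hf0 j i h)
    (fun i => (hle f hf _).trans (hz i).le)
  obtain ⟨T, hkT, hT⟩ := exists_support_subset_range a k
  have hvT : v = ∑ i ∈ Finset.range T, a i • z i := (sum_range_eq_sum_support a z hT).symm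
  have hA : ∀ i, |a i| ≤ 4 * ‖v‖ := by
    intro i
    by_cases hi : i < T
    · have := hP.norm_term_le a hi
      rw [norm_smul, hz, mul_one, Real.norm_eq_abs, ← hvT] at this
      refine this.trans ?_
      gcongr
      linarith
    · have : a i = 0 := by
        by_contra h0
        exact hi (Finset.mem_range.1 (hT (Finsupp.mem_support_iff.2 h0)))
      rw [this, abs_zero]
      positivity
  set G : ℕ → Finset ℕ := fun j => (F j).filter fun i => k ≤ i with hG
  have hGF : ∀ j, ∀ i ∈ G j, i ∈ F j := fun j i hi => (Finset.mem_filter.1 hi).1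
  have hGW : ∀ j, G j ⊆ Finset.Ico k T := by
    intro j i hi
    obtain ⟨h1, h2⟩ := Finset.mem_filter.1 hi
    exact Finset.mem_Ico.2 ⟨h2, Finset.mem_range.1
      (hT (Finsupp.mem_support_iff.2 (hpos j i h1).ne'))⟩
  have hGdisj : ∀ i j, i ≠ j → Disjoint (G i) (G j) := fun i j hij =>
    Finset.disjoint_left.2 fun p hi hj => hdisj i j hij p (hGF i p hi) (hGF j p hj)
  -- The weight of a piece is its least coefficient, or 0 if the cutoff has emptied it.
  have hb : ∀ j, ∃ b : ℝ, 0 ≤ b ∧ b ≤ D * a i₀ ∧ ∀ i ∈ G j, b ≤ a i ∧ a i ≤ d * b := by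
    intro j
    rcases Finset.eq_empty_or_nonempty (G j) with h0 | hne
    · exact ⟨0, le_rfl, by positivity, by simp [h0]⟩
    · obtain ⟨i, hi, hi'⟩ := Finset.exists_min_image (G j) a hne
      exact ⟨a i, (hpos j i (hGF j i hi)).le, haD j j₀ i (hGF j i hi) i₀ hij₀,
        fun q hq => ⟨hi' q hq, had j q (hGF j q hq) i (hGF j i hi)⟩⟩
  choose b hb0 hbD hba using hb
  have hμ0 : ∀ j, 0 ≤ ∑ i ∈ G j, f (z i) := fun j =>
    Finset.sum_nonneg fun i hi => hf0 j i (hGF j i hi)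
  have hμ : ∀ j, ∑ i ∈ G j, f (z i) ≤ massBound D δ k := by
    intro j
    refine le_trans (Finset.sum_le_sum_of_subset_of_nonneg ?_ ?_) hmass
    · exact fun i hi => (hmemE i).2 ⟨j, hGF j i hi⟩
    · exact fun i hi _ => let ⟨j, h⟩ := (hmemE i).1 hi; hf0 j i h
  obtain ⟨P, hPk, hsize, herr, hgrid, hsuff⟩ := exists_gridPattern hD hδ k
    (fun j => ∑ i ∈ G j, f (z i)) b hμ0 hμ
  have hG0 : ∀ j ≥ k + 1, G j = ∅ := fun j hj => by simp [hG, hF0 j (hnk.trans hj)]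
  obtain ⟨g, hg, hclean⟩ := hc k P hPk T hkT.le G hGW (by rwa [hsize])
    (fun i j hij p hp q hq => hFs i j hij p (hGF i p hp) q (hGF j q hq)) f hf
    ⟨fun j _ i hi => hf0 j i (hGF j i hi), fun j hj => (hgrid j (by omega)).1⟩
  obtain ⟨J, hJ, hJr, hlow⟩ := hclean.exists_le_sum hGW hGdisj (by positivity) hA hb0
    fun j i hi => (hba j i hi).1
  rw [hsize] at hJr
  set S := ∑ j ∈ Finset.range (k + 1), b j * P.mass j with hS
  have hJS : S ≤ 2 * ∑ j ∈ J, b j * P.mass j := hsuff J hJ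
  have herr0 : 0 < patternErr D δ k := patternErr_pos hD hδ k
  have herrδ : patternErr D δ k ≤ δ := patternErr_le hD hδ k
  -- The factor `(k + 1) * D` in `patternErr` is there to absorb `k + 1` weights of size at most `D
  -- * a i₀`.
  have hbsum : (∑ j ∈ Finset.range (k + 1), b j) * patternErr D δ k ≤ δ * a i₀ := by
    have h1 : ∑ j ∈ Finset.range (k + 1), b j ≤ (k + 1) * (D * a i₀) := by
      have := Finset.sum_le_card_nsmul (Finset.range (k + 1)) b (D * a i₀) fun j _ => hbD j
      rw [Finset.card_range, nsmul_eq_mul] at this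
      exact_mod_cast this
    calc _ ≤ ((k + 1) * (D * a i₀)) * patternErr D δ k := by gcongr
      _ = ((k + 1) * D * patternErr D δ k) * a i₀ := by ring
      _ = _ := by rw [mul_patternErr hD]
  have hβA : a i₀ ≤ 4 * ‖v‖ := (le_abs_self _).trans (hA i₀)
  have hupper : ∑ i ∈ E with k ≤ i, a i * f (z i) ≤ d * S + d * (δ * a i₀) := by
    have h1 : E.filter (fun i => k ≤ i) = (Finset.range (k + 1)).biUnion G := by
      ext i
      simp only [Finset.mem_filter, hmemE, Finset.mem_biUnion, Finset.mem_range, hG]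
      constructor
      · rintro ⟨⟨j, hj⟩, hki⟩
        refine ⟨j, ?_, hj, hki⟩
        by_contra hjk
        simp [hF0 j (by omega)] at hj
      · rintro ⟨j, _, hj, hki⟩
        exact ⟨⟨j, hj⟩, hki⟩
    rw [h1, Finset.sum_biUnion fun i _ j _ hij => hGdisj i j hij]
    have h2 : ∀ j ∈ Finset.range (k + 1), ∑ i ∈ G j, a i * f (z i) ≤
        d * (b j * P.mass j) + d * (b j * patternErr D δ k) := by
      intro j hj
      have h3 : ∑ i ∈ G j, a i * f (z i) ≤ d * b j * ∑ i ∈ G j, f (z i) := by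
        rw [Finset.mul_sum]
        exact Finset.sum_le_sum fun i hi =>
          mul_le_mul_of_nonneg_right (hba j i hi).2 (hf0 j i (hGF j i hi))
      have h4 := mul_le_mul_of_nonneg_left (hgrid j (Finset.mem_range.1 hj)).2
        (mul_nonneg (zero_le_one.trans hd) (hb0 j))
      linarith
    refine (Finset.sum_le_sum h2).trans ?_
    rw [Finset.sum_add_distrib, ← Finset.mul_sum, ← Finset.mul_sum, ← Finset.sum_mul]
    gcongr
  have hg' : ∑ i ∈ Finset.Ico k T, a i * g (z i) ≤ (2 + δ) * ‖v‖ := by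
    have h1 : ∑ i ∈ Finset.Ico k T, a i * g (z i) = g (∑ i ∈ Finset.Ico k T, a i • z i) := by
      simp [map_sum]
    have h2 := hP a k T hkT.le
    rw [← hvT] at h2
    rw [h1, Finset.sum_Ico_eq_sub _ hkT.le, ← hvT]
    refine (hle g hg _).trans ((norm_sub_le _ _).trans ?_)
    linarith
  have hlow' : ∑ j ∈ J, b j * P.mass j - δ * a i₀ - 4 * ‖v‖ * δ ≤ (2 + δ) * ‖v‖ := by
    refine le_trans ?_ (hlow.trans hg')
    rw [herr]
    simp only [mul_sub, Finset.sum_sub_distrib]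
    rw [← Finset.sum_mul]
    have h1 : (∑ j ∈ J, b j) * patternErr D δ k ≤
        (∑ j ∈ Finset.range (k + 1), b j) * patternErr D δ k := by
      gcongr
      exact fun _ _ _ => hb0 _
    have h2 : 4 * ‖v‖ * patternErr D δ k ≤ 4 * ‖v‖ * δ := by gcongr
    linarith
  have hβδ : δ * a i₀ ≤ δ * (4 * ‖v‖) := by gcongr
  -- The 22 is `2 * (1 + 4 + 4) + 4`: tail, cleaning error and rounding error, doubled, plus one
  -- further rounding error.
  have hfin : S + δ * a i₀ ≤ (4 + 22 * δ) * ‖v‖ := by linarith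
  calc _ ≤ d * (S + δ * a i₀) := by linarith
    _ ≤ d * ((4 + 22 * δ) * ‖v‖) := by gcongr
    _ = _ := by ring

theorem HasCleanFunctionals.norm_sum_le {D d δ : ℝ} (hD : 1 ≤ D) (hd : 1 ≤ d) (hδ : 0 < δ)
    (hδ1 : δ ≤ 1) {z : ℕ → X} (hz : ∀ i, ‖z i‖ = 1) (hP : HasPartialSumBound (1 + δ) z)
    (hc : HasCleanFunctionals D δ z) (a : ℕ →₀ ℝ) {E : Finset ℕ} (hE : osc a E ≤ D) {n : ℕ}
    {F : Fin n → Finset ℕ} (hF : IsSchreierDecomposition E n F) (hFd : ∀ j, osc a (F j) ≤ d) :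
    (1 - δ) * ‖∑ i ∈ E, a i • z i‖ ≤
      2 * (d * (4 + 22 * δ) * ‖∑ i ∈ a.support, a i • z i‖) := by
  classical
  obtain ⟨f, hf, hfw⟩ := exists_dual_vector'' ℝ (∑ i ∈ E, a i • z i)
  have hfw' : ‖∑ i ∈ E, a i • z i‖ = ∑ i ∈ E, a i * f (z i) := by
    have h : f (∑ i ∈ E, a i • z i) = ‖∑ i ∈ E, a i • z i‖ := by simpa using hfw
    rw [← h]
    simp [map_sum]
  have hFE : ∀ j, F j ⊆ E := fun j i hi => by
    rw [hF.union]
    exact Finset.mem_biUnion.2 ⟨j, Finset.mem_univ j, hi⟩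
  -- Multiplying both `a` and `f` by the sign `s` reduces the negative case to the positive one.
  have key : ∀ s : ℝ, |s| = 1 → (1 - δ) *
      ∑ i ∈ E with 0 < s * a i ∧ 0 ≤ s * f (z i), a i * f (z i) ≤
        d * (4 + 22 * δ) * ‖∑ i ∈ a.support, a i • z i‖ := by
    intro s hs
    have hss : s * s = 1 := by rw [← abs_mul_abs_self, hs, one_mul]
    have hs0 : s ≠ 0 := by rintro rfl; simp at hs
    set F' : ℕ → Finset ℕ := fun j => if hj : j < n then
      (F ⟨j, hj⟩).filter fun i => 0 < s * a i ∧ 0 ≤ s * f (z i) else ∅ with hF'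
    have hmem : ∀ j i, i ∈ F' j ↔
        ∃ hj : j < n, i ∈ F ⟨j, hj⟩ ∧ 0 < s * a i ∧ 0 ≤ s * f (z i) := by
      intro j i
      by_cases hj : j < n
      · simp only [hF', dif_pos hj, Finset.mem_filter, hj, exists_true_left]
      · simp only [hF', dif_neg hj, Finset.notMem_empty, hj, IsEmpty.exists_iff]
    have habs : ∀ i, 0 < s * a i → |a i| = s * a i := by
      intro i hi
      rw [← abs_of_pos hi, abs_mul, hs, one_mul]
    have hE' : (Finset.range n).biUnion F' =
        E.filter fun i => 0 < s * a i ∧ 0 ≤ s * f (z i) := by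
      ext i
      simp only [Finset.mem_biUnion, Finset.mem_range, hmem, Finset.mem_filter]
      constructor
      · rintro ⟨j, _, hj, hi, h⟩
        exact ⟨hFE _ hi, h⟩
      · rintro ⟨hi, h⟩
        rw [hF.union] at hi
        obtain ⟨j, -, hij⟩ := Finset.mem_biUnion.1 hi
        exact ⟨j, j.2, j.2, hij, h⟩
    have h := hc.sum_le hD hd hδ hδ1 hz hP (s • a) (n := n) (F := F') (f := s • f)
      (fun j hj => by simp [hF', not_lt.2 hj])
      (fun i j hij p hp q hq => by
        obtain ⟨h1, h2, -⟩ := (hmem i p).1 hp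
        obtain ⟨h3, h4, -⟩ := (hmem j q).1 hq
        exact hF.successive _ _ hij p h2 q h4)
      (fun j i hi => by
        obtain ⟨h1, h2, -⟩ := (hmem j i).1 hi
        exact hF.schreier i (hFE _ h2))
      (fun j i hi => by
        obtain ⟨h1, h2, h3, -⟩ := (hmem j i).1 hi
        simpa using h3)
      (fun j j' i hi i' hi' => by
        obtain ⟨h1, h2, h3, -⟩ := (hmem j i).1 hi
        obtain ⟨h1', h2', h3', -⟩ := (hmem j' i').1 hi'
        have := abs_le_of_osc_le hE (hFE _ h2) (hFE _ h2') (right_ne_zero_of_mul h3'.ne')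
        rw [habs i h3, habs i' h3'] at this
        simpa using this)
      (fun j i hi i' hi' => by
        obtain ⟨h1, h2, h3, -⟩ := (hmem j i).1 hi
        obtain ⟨h1', h2', h3', -⟩ := (hmem j i').1 hi'
        have := abs_le_of_osc_le (hFd _) h2 h2' (right_ne_zero_of_mul h3'.ne')
        rw [habs i h3, habs i' h3'] at this
        simpa using this)
      (by rw [norm_smul, Real.norm_eq_abs, hs, one_mul]; exact hf)
      (fun j i hi => by
        obtain ⟨h1, h2, -, h4⟩ := (hmem j i).1 hi
        simpa using h4)
    rw [hE'] at h
    have hsupp : (s • a).support = a.support := Finsupp.support_smul_eq hs0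
    have hv : ‖∑ i ∈ (s • a).support, (s • a) i • z i‖ = ‖∑ i ∈ a.support, a i • z i‖ := by
      rw [hsupp]
      simp only [Finsupp.smul_apply, smul_eq_mul, mul_smul]
      rw [← Finset.smul_sum, norm_smul, Real.norm_eq_abs, hs, one_mul]
    rw [hv] at h
    convert h using 3 with i hi
    simp only [Finsupp.smul_apply, smul_eq_mul, smul_apply]
    linear_combination (-(a i * f (z i))) * hss
  have h1 := key 1 (by simp)
  have h2 := key (-1) (by simp)
  have h3 : ∑ i ∈ E, a i * f (z i) ≤
      ∑ i ∈ E with 0 < 1 * a i ∧ 0 ≤ 1 * f (z i), a i * f (z i) +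
      ∑ i ∈ E with 0 < -1 * a i ∧ 0 ≤ -1 * f (z i), a i * f (z i) := by
    rw [Finset.sum_filter, Finset.sum_filter, ← Finset.sum_add_distrib]
    refine Finset.sum_le_sum fun i _ => ?_
    rcases lt_trichotomy (a i) 0 with ha | ha | ha
    · rcases le_or_gt (f (z i)) 0 with hfi | hfi
      · rw [if_neg (by rintro ⟨h, -⟩; linarith), if_pos ⟨by linarith, by linarith⟩, zero_add]
      · rw [if_neg (by rintro ⟨h, -⟩; linarith), if_neg (by rintro ⟨-, h⟩; linarith), zero_add]
        exact (mul_neg_of_neg_of_pos ha hfi).le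
    · simp [ha]
    · rcases le_or_gt 0 (f (z i)) with hfi | hfi
      · rw [if_pos ⟨by linarith, by linarith⟩, if_neg (by rintro ⟨h, -⟩; linarith), add_zero]
      · rw [if_neg (by rintro ⟨-, h⟩; linarith), if_neg (by rintro ⟨h, -⟩; linarith), zero_add]
        exact (mul_neg_of_pos_of_neg ha hfi).le
  rw [hfw']
  have h4 := mul_le_mul_of_nonneg_left h3 (sub_nonneg.2 hδ1)
  linarith

end

end BoundedOsc

end

/-! ### Choice of constants -/

theorem theorem2p1 (d : ℝ) (hd : 1 ≤ d) :
    ∃ C : ℝ, 1 ≤ C ∧ C ≤ 8 * d ∧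
      ∀ (D ε : ℝ), 1 ≤ D → 0 < ε →
        ∀ (X : Type*) [NormedAddCommGroup X] [NormedSpace ℝ X] [CompleteSpace X] (x : ℕ → X),
          (∀ i, ‖x i‖ = 1) → BoundedOsc.IsWeaklyNull x →
            ∃ φ : ℕ → ℕ, StrictMono φ ∧
              BoundedOsc.IsBasicSequenceWith (C + ε) (x ∘ φ) ∧
              BoundedOsc.IsBoundedOscUnconditional D d (C + ε) (x ∘ φ) := by
  refine ⟨8 * d, by linarith, le_rfl, fun D ε hD hε X _ _ _ x hx1 hx => ?_⟩
  -- This solves `2 * d * (4 + 22 * δ) = (1 - δ) * (8 * d + ε)`, whence `52 = 44 + 8`.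
  obtain ⟨δ, hδ, hδ1, hδε⟩ : ∃ δ : ℝ, 0 < δ ∧ δ < 1 ∧ (52 * d + ε) * δ = ε := by
    have h : 0 < 52 * d + ε := by positivity
    refine ⟨ε / (52 * d + ε), by positivity, (div_lt_one h).2 (by linarith), ?_⟩
    field_simp
  obtain ⟨m, hm, hPm⟩ := BoundedOsc.exists_subsequence_hasPartialSumBound hx hx1 hδ
  obtain ⟨l, hl, hcl⟩ := BoundedOsc.exists_subsequence_hasCleanFunctionals (hx.comp hm) hD hδ
  have hP := hPm.comp hl
  have hz : ∀ i, ‖((x ∘ m) ∘ l) i‖ = 1 := fun i => hx1 _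
  have hbasic := (hP.isBasicSequenceWith fun i => norm_pos_iff.1 (by rw [hz]; exact one_pos)).mono
    (show 1 + δ ≤ 8 * d + ε by linarith)
  refine ⟨m ∘ l, hm.comp hl, hbasic, hbasic.isBasicSequence, ?_⟩
  rintro a E hE ⟨n, F, hF, hFd⟩
  have h := hcl.norm_sum_le hD hd hδ hδ1.le hz hP a hE hF hFd
  have h1 : 2 * (d * (4 + 22 * δ)) = (1 - δ) * (8 * d + ε) := by
    linear_combination hδε
  refine le_of_mul_le_mul_left ?_ (sub_pos.2 hδ1)
  rw [← mul_assoc, ← h1]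
  calc _ ≤ _ := h
    _ = _ := by ring_nf; rfl
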